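/- For $\gamma>-1$ (and $\gamma<2$ in the first two lines) and $x\in\mathbb R$ put $$\mathrm{Ai}_\gamma(x)=\frac1\pi\int_0^\infty\sigma^\gamma\cos\Big(\frac{\sigma^3}3+x\sigma-\frac{\gamma\pi}2\Big)d\sigma,$$ $$\mathrm{Gi}_\gamma(x)=\frac1\pi\int_0^\infty\sigma^\gamma\sin\Big(\frac{\sigma^3}3+x\sigma-\frac{\gamma\pi}2\Big)d\sigma,$$ $$\mathrm{Hi}_\gamma(x)=\frac1\pi\int_0^\infty\sigma^\gamma e^{-\sigma^3/3+x\sigma}\,d\sigma,$$ where the first two integrals are (conditionally convergent) improper Riemann integrals $\lim_{R\to\infty}\int_0^R$. Let $-1<\gamma<0$ and $L_\gamma u=(1+\gamma)u+xu_x-u_{xxx}$. Let $C_c(\mathbb R)$ be the space of real-valued continuous compactly supported functions on $\mathbb R$, and let $X_0$ be the space of all $u\in C^1(\mathbb R)$ with $$\sup_{x\in\mathbb R}\Big((1+|x|)^{1+\gamma}|u(x)|+(1+|x|)^{2+\gamma}|u_x(x)|\Big)<\infty .$$ Then there is exactly one map $T_\gamma:C_c(\mathbb R)\to X_0$ that is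 a right inverse of $L_\gamma$, i.e. such that $L_\gamma T_\gamma f=f$ in the sense of distributions for all $f\in C_c(\mathbb R)$. This map is linear, $T_\gamma f$ is of class $C^3$ and satisfies $L_\gamma T_\gamma f=f$ pointwise, and $T_\gamma f(x)=\int_{\mathbb R}K_\gamma(x,y)f(y)\,dy$ with an integrable integrand for all $x\in\mathbb R$, where $$\begin{aligned}K_\gamma(x,y)=\;&\pi\Big(\mathrm{Ai}_{-1-\gamma}(y)\,\mathrm{Hi}_\gamma(x)\,\chi_{x<y}-\mathrm{Hi}_{-1-\gamma}(y)\,\mathrm{Ai}_\gamma(x)\,\chi_{y<x}\Big)\\&-\pi\sin(\gamma\pi)\Big(\mathrm{Gi}_{-1-\gamma}(y)\,\mathrm{Gi}_\gamma(x)+\mathrm{Ai}_{-1-\gamma}(y)\,\mathrm{Ai}_\gamma(x)\Big)\chi_{y<x}\\&-\pi\cos(\gamma\pi)\Big(\mathrm{Ai}_{-1-\gamma}(y)\,\mathrm{Gi}_\gamma(x)-\mathrm{Gi}_{-1-\gamma}(y)\,\mathrm{Ai}_\gamma(x)\Big)\chi_{y<x}.\end{aligned}$$ -/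

import Mathlib

open MeasureTheory Filter
open scoped CompactlySupported ContDiff

noncomputable section

/-- The generalized Airy function
`Ai_γ(x) = (1/π) ∫_0^∞ σ^γ cos(σ³/3 + xσ - γπ/2) dσ`, the integral being the (conditionally
convergent) improper integral; it converges for `-1 < γ < 2`. -/
def genAi (γ x : ℝ) : ℝ :=
  (1 / Real.pi) * limUnder atTop (fun R : ℝ =>
    ∫ σ in (0 : ℝ)..R, σ ^ γ * Real.cos (σ ^ 3 / 3 + x * σ - γ * Real.pi / 2))

/-- The generalized Scorer function of the first kind
`Gi_γ(x) = (1/π) ∫_0^∞ σ^γ sin(σ³/3 + xσ - γπ/2) dσ` (improper integral, `-1 < γ < 2`). -/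
def genGi (γ x : ℝ) : ℝ :=
  (1 / Real.pi) * limUnder atTop (fun R : ℝ =>
    ∫ σ in (0 : ℝ)..R, σ ^ γ * Real.sin (σ ^ 3 / 3 + x * σ - γ * Real.pi / 2))

/-- The generalized Scorer function of the second kind
`Hi_γ(x) = (1/π) ∫_0^∞ σ^γ exp(-σ³/3 + xσ) dσ` (absolutely convergent for `γ > -1`). -/
def genHi (γ x : ℝ) : ℝ :=
  (1 / Real.pi) * ∫ σ in Set.Ioi (0 : ℝ), σ ^ γ * Real.exp (-(σ ^ 3 / 3) + x * σ)

/-- The integral kernel `K_γ(x, y)`, explicit in terms of `Ai`, `Gi`, `Hi` with index `γ` at `x`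
and index `-1 - γ` at `y`. Its value on the diagonal is immaterial. -/
def greenKernel (γ x y : ℝ) : ℝ :=
  if x < y then Real.pi * (genAi (-1 - γ) y * genHi γ x)
  else if y < x then
    -(Real.pi * (genHi (-1 - γ) y * genAi γ x))
    - Real.pi * Real.sin (γ * Real.pi) *
        (genGi (-1 - γ) y * genGi γ x + genAi (-1 - γ) y * genAi γ x)
    - Real.pi * Real.cos (γ * Real.pi) *
        (genAi (-1 - γ) y * genGi γ x - genGi (-1 - γ) y * genAi γ x)
  else 0

/-- The differential operator `L_γ u = (1+γ) u + x u' - u'''`. -/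
def opL (γ : ℝ) (u : ℝ → ℝ) (x : ℝ) : ℝ :=
  (1 + γ) * u x + x * deriv u x - iteratedDeriv 3 u x

/-- `L_γ u = f` in the sense of distributions: for every test function `φ`,
`∫ u ((1+γ) φ - (x φ)' + φ''') = ∫ f φ`. -/
def WeakEqL (γ : ℝ) (u f : ℝ → ℝ) : Prop :=
  ∀ φ : ℝ → ℝ, ContDiff ℝ ∞ φ → HasCompactSupport φ →
    ∫ x, u x * ((1 + γ) * φ x - deriv (fun t => t * φ t) x + iteratedDeriv 3 φ x)
      = ∫ x, f x * φ x

/-- The space `X_0`: all `C^1` functions `u : ℝ → ℝ` with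
`sup_x ((1+|x|)^(1+γ) |u(x)| + (1+|x|)^(2+γ) |u'(x)|) < ∞`. -/
def spaceX (γ : ℝ) : Submodule ℝ (ℝ → ℝ) where
  carrier := {u | ContDiff ℝ 1 u ∧ BddAbove (Set.range fun x : ℝ =>
    (1 + |x|) ^ (1 + γ) * |u x| + (1 + |x|) ^ (2 + γ) * |deriv u x|)}
  zero_mem' := by
    refine ⟨contDiff_const, 0, ?_⟩
    rintro _ ⟨x, rfl⟩
    have h : deriv (0 : ℝ → ℝ) x = 0 := deriv_const x (0 : ℝ)
    simp [h]
  add_mem' := by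
    rintro u v ⟨hu, C, hC⟩ ⟨hv, D, hD⟩
    refine ⟨hu.add hv, C + D, ?_⟩
    rintro _ ⟨x, rfl⟩
    have hx := hC ⟨x, rfl⟩
    have hy := hD ⟨x, rfl⟩
    have hd : deriv (u + v) x = deriv u x + deriv v x :=
      deriv_add (hu.differentiable one_ne_zero x) (hv.differentiable one_ne_zero x)
    have p : 0 ≤ (1 + |x|) ^ (1 + γ) := by positivity
    have q : 0 ≤ (1 + |x|) ^ (2 + γ) := by positivity
    have h1 := mul_le_mul_of_nonneg_left (abs_add_le (u x) (v x)) p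
    have h2 := mul_le_mul_of_nonneg_left (abs_add_le (deriv u x) (deriv v x)) q
    simp only [Pi.add_apply, hd] at *
    linarith
  smul_mem' := by
    rintro c u ⟨hu, C, hC⟩
    refine ⟨hu.const_smul c, |c| * C, ?_⟩
    rintro _ ⟨x, rfl⟩
    have hx := mul_le_mul_of_nonneg_left (hC ⟨x, rfl⟩) (abs_nonneg c)
    have hd : deriv (c • u) x = c * deriv u x := by
      simpa using deriv_const_smul c (hu.differentiable one_ne_zero x)
    simp only [Pi.smul_apply, smul_eq_mul, hd, abs_mul] at *
    linarith

/-- `T` is a right inverse of `L_γ` on the compactly supported continuous functions: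
`L_γ (T f) = f` for all `f`. Elements of `X_0` are only `C^1`, so the equation is taken in the
sense of distributions. -/
def IsRightInverseL (γ : ℝ) (T : C_c(ℝ, ℝ) → spaceX γ) : Prop :=
  ∀ f : C_c(ℝ, ℝ), WeakEqL γ (T f : ℝ → ℝ) f

end

/-! Let F_γ(z) = ∫_0^∞ t^γ exp(-t³/3 + zt) dt. Then F_γ' = F_{γ+1}, and integrating a total
derivative gives F_γ''' = z F_γ' + (γ+1) F_γ. Hence x ↦ F_γ(ωx) solves L_γ u = 0 whenever ω³ = 1
(`airyLaplace_add_three`). Turning the contour by π/6 identifies Ai_γ + i Gi_γ with a multiple of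
F_γ(e^{2πi/3} x) (`tendsto_oscillatory`), while Hi_γ is F_γ/π on the real line. So Ai_γ and Gi_γ
decay like x^{-1-γ} at +∞, Hi_γ does so at -∞, and each derivative gains one power.

Existence is variation of constants. The kernel uses Hi_γ(x) for x < y and Ai_γ(x), Gi_γ(x) for x >
y, so for f of compact support only decaying solutions survive at each end, which gives membership
in X_0. What remains are the jump conditions on the diagonal (`sum_solJet_mul_kernel`). The
functions of index -1-γ solve the adjoint equation, so by Lagrange's identity the bilinear
concomitant is constant (`concomitant_const`). The jump conditions thus reduce to x = 0, where
Euler's reflection formula settles them (`wronskian_kernel_at_zero`).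

For uniqueness let u ∈ X_0 solve L_γ u = 0 weakly. On the Fourier side the equation is of first
order, so û is determined on each half line by one value and behaves like |ξ|^γ there, whereas û' s
counterpart ξ û is bounded because u' is integrable; since γ > -1 these are incompatible unless û
vanishes off 0. The rigorous version tests with truncations of ∫_a^b s^{-γ-1} cos(s³/3 + xs + θ) ds,
on which the adjoint operator leaves only endpoint terms (`adjoint_oscJet`). Letting b → ∞ kills the
Fourier transform of u' off 0, so u is constant and, decaying, zero. -/

/-! ### The Laplace-type integral `∫ t^γ exp (-t³/3 + z t)` -/

/-- The integrand of `airyLaplace`. -/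
noncomputable def airyIntegrand (γ : ℝ) (z : ℂ) (t : ℝ) : ℂ :=
  ((t ^ γ : ℝ) : ℂ) * Complex.exp (-((t ^ 3 / 3 : ℝ) : ℂ) + z * t)

/-- The entire function `z ↦ ∫_0^∞ t^γ exp (-t³/3 + z t) dt`. -/
noncomputable def airyLaplace (γ : ℝ) (z : ℂ) : ℂ :=
  ∫ t in Set.Ioi (0 : ℝ), airyIntegrand γ z t

theorem norm_airyIntegrand (γ : ℝ) (z : ℂ) {t : ℝ} (ht : 0 ≤ t) :
    ‖airyIntegrand γ z t‖ = t ^ γ * Real.exp (-(t ^ 3 / 3) + z.re * t) := by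
  rw [airyIntegrand, norm_mul, Complex.norm_real, Real.norm_of_nonneg (Real.rpow_nonneg ht _),
    Complex.norm_exp]
  congr 2
  rw [Complex.add_re, Complex.neg_re, Complex.ofReal_re, Complex.re_mul_ofReal]

theorem neg_cube_add_le {t M : ℝ} (ht : 0 ≤ t) (hM : 0 ≤ M) :
    -(t ^ 3 / 3) + M * t ≤ 2 * (M + 1) ^ 3 / 3 - t := by
  -- On t ≥ 0 the graph of t³/3 lies above its tangent at t = M + 1, whose slope (M+1)² exceeds M by
  -- at least 1.
  have h : 0 ≤ (t - (M + 1)) ^ 2 * (t + 2 * (M + 1)) := by positivity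
  nlinarith [mul_nonneg ht hM, mul_nonneg (mul_nonneg ht hM) hM]

/-- Uniformity over a half plane makes this one majorant serve for integrability, for
differentiation in z and for the limit t → ∞. -/
theorem norm_airyIntegrand_le (γ : ℝ) {z : ℂ} {M t : ℝ} (ht : 0 ≤ t) (hM : 0 ≤ M)
    (hz : z.re ≤ M) :
    ‖airyIntegrand γ z t‖ ≤ Real.exp (2 * (M + 1) ^ 3 / 3) * (t ^ γ * Real.exp (-t)) := by
  rw [norm_airyIntegrand γ z ht, mul_left_comm, ← Real.exp_add]
  refine mul_le_mul_of_nonneg_left (Real.exp_le_exp.2 ?_) (Real.rpow_nonneg ht _)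
  have := neg_cube_add_le ht hM
  have := mul_le_mul_of_nonneg_right hz ht
  linarith

theorem integrableOn_rpow_mul_exp_neg {γ : ℝ} (hγ : -1 < γ) :
    IntegrableOn (fun t : ℝ => t ^ γ * Real.exp (-t)) (Set.Ioi 0) := by
  have := Real.GammaIntegral_convergent (s := γ + 1) (by linarith)
  refine this.congr_fun (fun t _ => ?_) measurableSet_Ioi
  simp [mul_comm]

theorem continuousOn_airyIntegrand (γ : ℝ) (z : ℂ) :
    ContinuousOn (airyIntegrand γ z) (Set.Ioi 0) := by
  unfold airyIntegrand
  refine ContinuousOn.mul ?_ (by fun_prop)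
  exact Complex.continuous_ofReal.comp_continuousOn
    (continuousOn_id.rpow_const fun t ht => Or.inl (ne_of_gt ht))

theorem aestronglyMeasurable_airyIntegrand (γ : ℝ) (z : ℂ) :
    AEStronglyMeasurable (airyIntegrand γ z) (volume.restrict (Set.Ioi 0)) :=
  (continuousOn_airyIntegrand γ z).aestronglyMeasurable measurableSet_Ioi

theorem integrableOn_airyIntegrand {γ : ℝ} (hγ : -1 < γ) (z : ℂ) :
    IntegrableOn (airyIntegrand γ z) (Set.Ioi 0) := by
  refine Integrable.mono' ((integrableOn_rpow_mul_exp_neg hγ).const_mul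
    (Real.exp (2 * (|z.re| + 1) ^ 3 / 3))) (aestronglyMeasurable_airyIntegrand γ z) ?_
  filter_upwards [ae_restrict_mem measurableSet_Ioi] with t ht
  exact norm_airyIntegrand_le γ (le_of_lt ht) (abs_nonneg _) (le_abs_self _)

theorem airyIntegrand_add_one (γ : ℝ) (z : ℂ) {t : ℝ} (ht : 0 < t) :
    airyIntegrand (γ + 1) z t = t * airyIntegrand γ z t := by
  simp only [airyIntegrand, Real.rpow_add_one ht.ne']
  push_cast; ring

theorem hasDerivAt_airyLaplace {γ : ℝ} (hγ : -1 < γ) (z : ℂ) :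
    HasDerivAt (airyLaplace γ) (airyLaplace (γ + 1) z) z := by
  refine (hasDerivAt_integral_of_dominated_loc_of_deriv_le (Metric.ball_mem_nhds z one_pos)
    (Eventually.of_forall fun w => aestronglyMeasurable_airyIntegrand γ w)
    (integrableOn_airyIntegrand hγ z) (aestronglyMeasurable_airyIntegrand (γ + 1) z)
    (bound := fun t => Real.exp (2 * (|z.re| + 1 + 1) ^ 3 / 3) * (t ^ (γ + 1) * Real.exp (-t)))
    ?_ ((integrableOn_rpow_mul_exp_neg (by linarith)).const_mul _) ?_).2
  · filter_upwards [ae_restrict_mem measurableSet_Ioi] with t ht w hw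
    refine norm_airyIntegrand_le _ (le_of_lt ht) (by positivity) ?_
    have h1 : |(w - z).re| ≤ ‖w - z‖ := Complex.abs_re_le_norm _
    have h2 : ‖w - z‖ < 1 := by rwa [← dist_eq_norm]
    rw [Complex.sub_re] at h1
    linarith [le_abs_self (w.re - z.re), le_abs_self z.re]
  · filter_upwards [ae_restrict_mem measurableSet_Ioi] with t ht w _
    rw [airyIntegrand_add_one γ w ht]
    have h : HasDerivAt (fun w : ℂ => -((t ^ 3 / 3 : ℝ) : ℂ) + w * t) (t : ℂ) w := by
      simpa using ((hasDerivAt_id w).mul_const (t : ℂ)).const_add (-((t ^ 3 / 3 : ℝ) : ℂ))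
    refine (h.cexp.const_mul ((t ^ γ : ℝ) : ℂ)).congr_deriv ?_
    simp only [airyIntegrand]
    ring

theorem hasDerivAt_airyIntegrand (γ : ℝ) (z : ℂ) {t : ℝ} (ht : 0 < t) :
    HasDerivAt (airyIntegrand (γ + 1) z)
      ((γ + 1) * airyIntegrand γ z t + z * airyIntegrand (γ + 1) z t
        - airyIntegrand (γ + 3) z t) t := by
  have h1 : HasDerivAt (fun t : ℝ => ((t ^ (γ + 1) : ℝ) : ℂ))
      (((γ + 1) * t ^ γ : ℝ) : ℂ) t := by
    simpa using (Real.hasDerivAt_rpow_const (p := γ + 1) (Or.inl ht.ne')).ofReal_comp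
  have h2 : HasDerivAt (fun t : ℝ => -((t ^ 3 / 3 : ℝ) : ℂ) + z * t)
      (-((t ^ 2 : ℝ) : ℂ) + z) t := by
    have h3 : HasDerivAt (fun t : ℝ => t ^ 3 / 3) (t ^ 2) t := by
      refine ((hasDerivAt_pow 3 t).div_const 3).congr_deriv ?_
      norm_num
    refine (h3.ofReal_comp.fun_neg.fun_add
      ((hasDerivAt_id t).ofReal_comp.const_mul z)).congr_deriv ?_
    simp
  refine (h1.fun_mul h2.cexp).congr_deriv ?_
  have e1 := Real.rpow_add_natCast ht.ne' γ 3
  have e2 := Real.rpow_add_one ht.ne' γ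
  norm_num at e1
  simp only [airyIntegrand, e1, e2]
  push_cast
  ring

/-- The derivative of t^{γ+1} exp(-t³/3 + zt) is integrated over the half line; both boundary terms
vanish because γ + 1 > 0. -/
theorem airyLaplace_add_three {γ : ℝ} (hγ : -1 < γ) (z : ℂ) :
    airyLaplace (γ + 3) z = z * airyLaplace (γ + 1) z + (γ + 1) * airyLaplace γ z := by
  have i0 := (integrableOn_airyIntegrand hγ z).const_mul ((γ : ℂ) + 1)
  have i1 := (integrableOn_airyIntegrand (γ := γ + 1) (by linarith) z).const_mul z
  have i3 := integrableOn_airyIntegrand (γ := γ + 3) (by linarith) z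
  have hz : airyIntegrand (γ + 1) z 0 = 0 := by
    simp [airyIntegrand, Real.zero_rpow (show γ + 1 ≠ 0 by linarith)]
  have hcont : ContinuousWithinAt (airyIntegrand (γ + 1) z) (Set.Ici 0) 0 := by
    unfold airyIntegrand
    refine ContinuousWithinAt.mul ?_ (Continuous.continuousWithinAt (by fun_prop))
    exact (Complex.continuous_ofReal.comp
      (Real.continuous_rpow_const (by linarith))).continuousWithinAt
  have hlim : Tendsto (airyIntegrand (γ + 1) z) atTop (nhds 0) := by
    refine squeeze_zero_norm' (a := fun t => Real.exp (2 * (|z.re| + 1) ^ 3 / 3) *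
      (t ^ (γ + 1) * Real.exp (-t))) ?_ ?_
    · filter_upwards [eventually_ge_atTop 0] with t ht
      exact norm_airyIntegrand_le _ ht (abs_nonneg _) (le_abs_self _)
    · simpa using (tendsto_rpow_mul_exp_neg_mul_atTop_nhds_zero (γ + 1) 1 one_pos).const_mul
        (Real.exp (2 * (|z.re| + 1) ^ 3 / 3))
  have key := integral_Ioi_of_hasDerivAt_of_tendsto hcont
    (fun t ht => hasDerivAt_airyIntegrand γ z ht) ((i0.add i1).sub i3) hlim
  rw [hz, sub_zero, integral_sub (i0.fun_add i1) i3, integral_add i0 i1,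
    integral_const_mul, integral_const_mul] at key
  simp only [airyLaplace]
  linear_combination -key

/-- Dropping exp(-t³/3) leaves a Gamma integral. The resulting power is the one that the weights of
X_0 require. -/
theorem norm_airyLaplace_le {γ : ℝ} (hγ : -1 < γ) {z : ℂ} {m : ℝ} (hm : 0 < m)
    (hz : z.re ≤ -m) : ‖airyLaplace γ z‖ ≤ Real.Gamma (γ + 1) * m ^ (-(1 + γ)) := by
  have h := Real.integral_rpow_mul_exp_neg_mul_Ioi (a := γ + 1) (r := m) (by linarith) hm
  have hr : (1 / m) ^ (γ + 1) = m ^ (-(1 + γ)) := by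
    rw [one_div, Real.inv_rpow hm.le, ← Real.rpow_neg hm.le, add_comm]
  rw [hr, mul_comm] at h
  rw [← h]
  refine norm_integral_le_of_norm_le ?_ ?_
  · refine Integrable.of_integral_ne_zero (h ▸ ?_)
    exact (mul_pos (Real.Gamma_pos_of_pos (by linarith)) (Real.rpow_pos_of_pos hm _)).ne'
  · filter_upwards [ae_restrict_mem measurableSet_Ioi] with t ht
    have ht' : 0 < t := ht
    rw [norm_airyIntegrand γ z ht'.le, add_sub_cancel_right]
    refine mul_le_mul_of_nonneg_left (Real.exp_le_exp.2 ?_) (Real.rpow_nonneg ht'.le _)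
    have := mul_le_mul_of_nonneg_right hz ht'.le
    have : 0 ≤ t ^ 3 / 3 := by positivity
    linarith

theorem airyLaplace_zero {γ : ℝ} (hγ : -1 < γ) :
    airyLaplace γ 0 = (((3 : ℝ) ^ ((γ - 2) / 3) * Real.Gamma ((γ + 1) / 3) : ℝ) : ℂ) := by
  have h := integral_rpow_mul_exp_neg_mul_rpow (p := 3) (q := γ) (b := 1 / 3) (by norm_num) hγ
    (by norm_num)
  have e : (1 / 3 : ℝ) ^ (-(γ + 1) / 3) * (1 / 3) = 3 ^ ((γ - 2) / 3) := by
    rw [one_div, Real.inv_rpow (by norm_num), ← Real.rpow_neg (by norm_num),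
      ← Real.rpow_neg_one, ← Real.rpow_add (by norm_num)]
    congr 1; ring
  rw [e] at h
  rw [← h, airyLaplace, ← integral_complex_ofReal]
  refine setIntegral_congr_fun measurableSet_Ioi fun t _ => ?_
  simp only [airyIntegrand, zero_mul, add_zero]
  push_cast
  norm_num
  left
  congr 1
  ring

theorem airyLaplace_ofReal (γ x : ℝ) :
    airyLaplace γ x =
      ((∫ t in Set.Ioi (0 : ℝ), t ^ γ * Real.exp (-(t ^ 3 / 3) + x * t) : ℝ) : ℂ) := by
  rw [airyLaplace, ← integral_complex_ofReal]
  refine setIntegral_congr_fun measurableSet_Ioi fun t _ => ?_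
  simp only [airyIntegrand]
  push_cast
  rfl

/-! ### Rotation of the contour in the oscillatory integral -/

/-- The phase function `z ↦ i (z³/3 + x z)`. -/
noncomputable def airyPhase (x : ℝ) (z : ℂ) : ℂ := Complex.I * (z ^ 3 / 3 + x * z)

/-- The point `r e^{iθ}`. -/
noncomputable def polarPoint (θ r : ℝ) : ℂ := r * Complex.exp (θ * Complex.I)

theorem hasDerivAt_airyPhase (x : ℝ) (z : ℂ) :
    HasDerivAt (airyPhase x) (Complex.I * (z ^ 2 + x)) z := by
  refine ((((hasDerivAt_pow 3 z).div_const 3).fun_add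
    ((hasDerivAt_id z).const_mul (x : ℂ))).const_mul Complex.I).congr_deriv ?_
  push_cast
  ring

theorem hasDerivAt_polarPoint_left (θ r : ℝ) :
    HasDerivAt (fun θ => polarPoint θ r) (Complex.I * polarPoint θ r) θ := by
  have h : HasDerivAt (fun θ : ℝ => (θ : ℂ) * Complex.I) Complex.I θ := by
    simpa using (hasDerivAt_id θ).ofReal_comp.mul_const Complex.I
  refine (h.cexp.const_mul (r : ℂ)).congr_deriv ?_
  simp only [polarPoint]
  ring

theorem hasDerivAt_polarPoint_right (θ r : ℝ) :
    HasDerivAt (fun r => polarPoint θ r) (Complex.exp (θ * Complex.I)) r := by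
  refine ((hasDerivAt_id r).ofReal_comp.mul_const (Complex.exp (θ * Complex.I))).congr_deriv ?_
  simp

theorem norm_polarPoint (θ : ℝ) {r : ℝ} (hr : 0 ≤ r) : ‖polarPoint θ r‖ = r := by
  rw [polarPoint, norm_mul, Complex.norm_exp_ofReal_mul_I, mul_one, Complex.norm_real,
    Real.norm_of_nonneg hr]

theorem norm_exp_airyPhase_le (x : ℝ) {z : ℂ} {R : ℝ} (hz : ‖z‖ ≤ R) :
    ‖Complex.exp (airyPhase x z)‖ ≤ Real.exp (R ^ 3 / 3 + |x| * R) := by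
  refine (Complex.norm_exp_le_exp_norm _).trans (Real.exp_le_exp.2 ?_)
  rw [airyPhase, norm_mul, Complex.norm_I, one_mul]
  refine (norm_add_le _ _).trans ?_
  rw [norm_div, norm_pow, norm_mul, Complex.norm_real, Real.norm_eq_abs, Complex.norm_ofNat]
  gcongr

theorem continuous_airyPhase_polar (x θ : ℝ) :
    Continuous fun r => airyPhase x (polarPoint θ r) := by
  unfold airyPhase polarPoint
  fun_prop

theorem intervalIntegrable_rpow_mul {γ : ℝ} (hγ : -1 < γ) {g : ℝ → ℂ} (hg : Continuous g)
    (a b : ℝ) : IntervalIntegrable (fun r : ℝ => ((r ^ γ : ℝ) : ℂ) * g r) volume a b := by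
  have h : IntervalIntegrable (fun r : ℝ => ((r ^ γ : ℝ) : ℂ)) volume a b :=
    ⟨Integrable.ofReal (intervalIntegral.intervalIntegrable_rpow' hγ).1,
      Integrable.ofReal (intervalIntegral.intervalIntegrable_rpow' hγ).2⟩
  exact h.mul_continuousOn hg.continuousOn

/-- The integral of `z^γ exp (i (z³/3 + x z))` along the segment from `0` to `R e^{iθ}`. -/
noncomputable def segmentIntegral (γ x R θ : ℝ) : ℂ :=
  Complex.exp ((γ + 1) * θ * Complex.I) *
    ∫ r in (0 : ℝ)..R, ((r ^ γ : ℝ) : ℂ) * Complex.exp (airyPhase x (polarPoint θ r))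

theorem hasDerivAt_integral_polar {γ : ℝ} (hγ : -1 < γ) (x θ : ℝ) {R : ℝ} (hR : 0 ≤ R) :
    HasDerivAt (fun θ => ∫ r in (0 : ℝ)..R,
        ((r ^ γ : ℝ) : ℂ) * Complex.exp (airyPhase x (polarPoint θ r)))
      (∫ r in (0 : ℝ)..R, ((r ^ γ : ℝ) : ℂ) * (Complex.exp (airyPhase x (polarPoint θ r)) *
        (Complex.I * (polarPoint θ r ^ 2 + x) * (Complex.I * polarPoint θ r)))) θ := by
  have hc : Continuous fun r => Complex.exp (airyPhase x (polarPoint θ r)) *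
      (Complex.I * (polarPoint θ r ^ 2 + x) * (Complex.I * polarPoint θ r)) := by
    unfold airyPhase polarPoint
    fun_prop
  refine (intervalIntegral.hasDerivAt_integral_of_dominated_loc_of_deriv_le
    (s := Set.univ)
    (F' := fun θ r => ((r ^ γ : ℝ) : ℂ) * (Complex.exp (airyPhase x (polarPoint θ r)) *
      (Complex.I * (polarPoint θ r ^ 2 + x) * (Complex.I * polarPoint θ r)))) (bound := fun r => r ^ γ * (Real.exp (R ^ 3 / 3 + |x| * R) *
      ((R ^ 2 + |x|) * R)))
    Filter.univ_mem (Eventually.of_forall fun θ => ?_)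
    (intervalIntegrable_rpow_mul hγ (continuous_airyPhase_polar x θ).cexp 0 R)
    (intervalIntegrable_rpow_mul hγ hc 0 R).def'.aestronglyMeasurable
    ?_ ((intervalIntegral.intervalIntegrable_rpow' hγ).mul_const _) ?_).2
  · exact (intervalIntegrable_rpow_mul hγ
      (continuous_airyPhase_polar x θ).cexp 0 R).def'.aestronglyMeasurable
  · refine Eventually.of_forall fun r hr θ _ => ?_
    rw [Set.uIoc_of_le hR] at hr
    have hn := norm_polarPoint θ hr.1.le
    rw [norm_mul, Complex.norm_real, Real.norm_of_nonneg (Real.rpow_nonneg hr.1.le _)]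
    refine mul_le_mul_of_nonneg_left ?_ (Real.rpow_nonneg hr.1.le _)
    rw [norm_mul]
    refine mul_le_mul (norm_exp_airyPhase_le x (hn.le.trans hr.2)) ?_ (norm_nonneg _)
      (Real.exp_pos _).le
    rw [norm_mul, norm_mul, norm_mul, Complex.norm_I, one_mul, one_mul, hn]
    have h2 : ‖polarPoint θ r ^ 2 + x‖ ≤ R ^ 2 + |x| := by
      refine (norm_add_le _ _).trans ?_
      rw [norm_pow, hn, Complex.norm_real, Real.norm_eq_abs]
      have := pow_le_pow_left₀ hr.1.le hr.2 2
      linarith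
    exact mul_le_mul h2 hr.2 hr.1.le (by positivity)
  · refine Eventually.of_forall fun r _ θ _ => ?_
    exact (((hasDerivAt_airyPhase x _).comp θ (hasDerivAt_polarPoint_left θ r)).cexp).const_mul _

/-- Cauchy's theorem for a circular sector in differential form: turning the segment changes its
integral only by the arc traced by the endpoint. Working in polar coordinates avoids a branch of
z^γ. -/
theorem hasDerivAt_segmentIntegral {γ : ℝ} (hγ : -1 < γ) (x θ : ℝ) {R : ℝ} (hR : 0 ≤ R) :
    HasDerivAt (segmentIntegral γ x R)
      (Complex.I * Complex.exp ((γ + 1) * θ * Complex.I) * ((R ^ (γ + 1) : ℝ) : ℂ) *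
        Complex.exp (airyPhase x (polarPoint θ R))) θ := by
  have hlin : HasDerivAt (fun θ : ℝ => ((γ : ℂ) + 1) * θ * Complex.I)
      ((γ + 1) * Complex.I) θ := by
    simpa using ((hasDerivAt_id θ).ofReal_comp.const_mul ((γ : ℂ) + 1)).mul_const Complex.I
  have hc : Continuous fun r => Complex.exp (airyPhase x (polarPoint θ r)) *
      (Complex.I * (polarPoint θ r ^ 2 + x) * (Complex.I * polarPoint θ r)) := by
    unfold airyPhase polarPoint
    fun_prop
  have i1 := (intervalIntegrable_rpow_mul hγ
    (continuous_airyPhase_polar x θ).cexp 0 R).const_mul ((γ : ℂ) + 1)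
  have i2 := (intervalIntegrable_rpow_mul hγ hc 0 R).const_mul (-Complex.I)
  -- On a holomorphic function of re^{iθ} one has ∂_θ = i r ∂_r, so this combination is the
  -- r-derivative of r^{γ+1} exp(phase).
  have key : ∫ r in (0 : ℝ)..R,
      (((γ : ℂ) + 1) * (((r ^ γ : ℝ) : ℂ) * Complex.exp (airyPhase x (polarPoint θ r))) +
        -Complex.I * (((r ^ γ : ℝ) : ℂ) * (Complex.exp (airyPhase x (polarPoint θ r)) *
        (Complex.I * (polarPoint θ r ^ 2 + x) * (Complex.I * polarPoint θ r))))) =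
      ((R ^ (γ + 1) : ℝ) : ℂ) * Complex.exp (airyPhase x (polarPoint θ R)) := by
    rw [intervalIntegral.integral_eq_sub_of_hasDerivAt_of_le hR
      (f := fun r => ((r ^ (γ + 1) : ℝ) : ℂ) * Complex.exp (airyPhase x (polarPoint θ r)))
      ?_ ?_ (i1.add i2)]
    · simp [Real.zero_rpow (show γ + 1 ≠ 0 by linarith)]
    · refine Continuous.continuousOn (Continuous.mul ?_ (continuous_airyPhase_polar x θ).cexp)
      exact Complex.continuous_ofReal.comp (Real.continuous_rpow_const (by linarith))
    · intro r hr
      have h1 : HasDerivAt (fun t : ℝ => ((t ^ (γ + 1) : ℝ) : ℂ))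
          (((γ + 1) * r ^ γ : ℝ) : ℂ) r := by
        simpa using (Real.hasDerivAt_rpow_const (p := γ + 1) (Or.inl hr.1.ne')).ofReal_comp
      refine (h1.fun_mul ((hasDerivAt_airyPhase x _).comp r
        (hasDerivAt_polarPoint_right θ r)).cexp).congr_deriv ?_
      simp only [Function.comp_apply, Real.rpow_add_one hr.1.ne']
      have hp : polarPoint θ r = r * Complex.exp (θ * Complex.I) := rfl
      push_cast
      generalize Complex.exp (airyPhase x (polarPoint θ r)) = E
      rw [hp]
      linear_combination (((r ^ γ : ℝ) : ℂ) * E *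
        Complex.I * ((r * Complex.exp (θ * Complex.I)) ^ 2 + x) *
          (r * Complex.exp (θ * Complex.I))) * Complex.I_sq
  rw [intervalIntegral.integral_add i1 i2, intervalIntegral.integral_const_mul,
    intervalIntegral.integral_const_mul] at key
  refine (hlin.cexp.fun_mul (hasDerivAt_integral_polar hγ x θ hR)).congr_deriv ?_
  generalize (∫ r in (0 : ℝ)..R, _ : ℂ) = A at key ⊢
  generalize (∫ r in (0 : ℝ)..R, _ : ℂ) = B at key ⊢
  rw [mul_assoc _ ((R ^ (γ + 1) : ℝ) : ℂ), ← key]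
  linear_combination (B * Complex.exp ((γ + 1) * θ * Complex.I)) * Complex.I_sq

/-- As in Jordan's lemma: 3θ ≤ π/2 bounds sin 3θ below by a multiple of θ, and for large R the cubic
term dominates the linear one. -/
theorem norm_exp_airyPhase_polar_le (x : ℝ) {R θ : ℝ} (hR : 2 * |x| + 2 ≤ R) (h0 : 0 ≤ θ)
    (hθ : θ ≤ Real.pi / 6) :
    ‖Complex.exp (airyPhase x (polarPoint θ R))‖ ≤ Real.exp (-R ^ 2 * θ) := by
  have hx := abs_nonneg x
  have hre : (airyPhase x (polarPoint θ R)).re =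
      -(R ^ 3 / 3 * Real.sin (3 * θ) + x * R * Real.sin θ) := by
    have h : airyPhase x (polarPoint θ R) =
        Complex.I * ((R ^ 3 / 3 : ℝ) * Complex.exp ((3 * θ : ℝ) * Complex.I) +
          (x * R : ℝ) * Complex.exp (θ * Complex.I)) := by
      rw [airyPhase, polarPoint, mul_pow, ← Complex.exp_nat_mul]
      push_cast
      ring_nf
    rw [h, Complex.I_mul_re, Complex.add_im, Complex.im_ofReal_mul, Complex.im_ofReal_mul,
      Complex.exp_ofReal_mul_I_im, Complex.exp_ofReal_mul_I_im]
  rw [Complex.norm_exp, hre]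
  refine Real.exp_le_exp.2 ?_
  have hpi := Real.pi_pos
  have s1 : 2 / Real.pi * (3 * θ) ≤ Real.sin (3 * θ) :=
    Real.mul_le_sin (by linarith) (by linarith)
  have s1' : 3 / 2 * θ ≤ Real.sin (3 * θ) := by
    refine le_trans ?_ s1
    have : 1 / 2 ≤ 2 / Real.pi := by
      rw [div_le_div_iff₀ (by norm_num) hpi]; linarith [Real.pi_le_four]
    nlinarith
  have s2 : |x * Real.sin θ| ≤ |x| * θ := by
    rw [abs_mul]
    refine mul_le_mul_of_nonneg_left ?_ hx
    have h := Real.sin_le h0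
    have h' : 0 ≤ Real.sin θ := Real.sin_nonneg_of_nonneg_of_le_pi h0 (by linarith)
    rwa [abs_of_nonneg h']
  have s3 := neg_abs_le (x * Real.sin θ)
  have hR0 : 0 ≤ R := by linarith
  have e1 : R ^ 3 / 3 * (3 / 2 * θ) ≤ R ^ 3 / 3 * Real.sin (3 * θ) :=
    mul_le_mul_of_nonneg_left s1' (by positivity)
  have e2 : R * (-(|x| * θ)) ≤ R * (x * Real.sin θ) :=
    mul_le_mul_of_nonneg_left (by linarith) hR0
  -- This is twice the needed inequality R³θ/2 - |x|Rθ ≥ R²θ, regrouped into nonnegative summands.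
  have e3 : 0 ≤ R * θ * (R * (R - 2 * |x| - 2) + 2 * |x| * (R - 1)) :=
    mul_nonneg (mul_nonneg hR0 h0) (add_nonneg (mul_nonneg hR0 (by linarith))
      (mul_nonneg (by linarith) (by linarith)))
  nlinarith

/-- The arc contributes at most the integral of R^{γ+1} e^{-R²θ} over θ, which gains R^{-2}; it
tends to zero once γ < 1. -/
theorem norm_segmentIntegral_sub_le {γ : ℝ} (hγ : -1 < γ) (x : ℝ) {R : ℝ}
    (hR : 2 * |x| + 2 ≤ R) :
    ‖segmentIntegral γ x R (Real.pi / 6) - segmentIntegral γ x R 0‖ ≤ R ^ (γ - 1) := by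
  have hR0 : 0 < R := by linarith [abs_nonneg x]
  have hpi : 0 ≤ Real.pi / 6 := by linarith [Real.pi_pos]
  have hcont : Continuous fun θ : ℝ =>
      Complex.I * Complex.exp ((γ + 1) * θ * Complex.I) * ((R ^ (γ + 1) : ℝ) : ℂ) *
        Complex.exp (airyPhase x (polarPoint θ R)) := by
    unfold airyPhase polarPoint
    fun_prop
  rw [← intervalIntegral.integral_eq_sub_of_hasDerivAt
    (fun θ _ => hasDerivAt_segmentIntegral hγ x θ hR0.le) (hcont.intervalIntegrable _ _)]
  have hexp : Continuous fun θ : ℝ => R ^ (γ + 1) * Real.exp (-R ^ 2 * θ) := by fun_prop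
  refine (intervalIntegral.norm_integral_le_of_norm_le hpi
    (g := fun θ => R ^ (γ + 1) * Real.exp (-R ^ 2 * θ)) (Eventually.of_forall fun θ hθ => ?_)
    (hexp.intervalIntegrable _ _)).trans ?_
  · have h1 : ‖Complex.exp (((γ : ℂ) + 1) * θ * Complex.I)‖ = 1 := by
      have := Complex.norm_exp_ofReal_mul_I ((γ + 1) * θ)
      push_cast at this
      exact this
    rw [norm_mul, norm_mul, norm_mul, h1, Complex.norm_I, one_mul, one_mul, Complex.norm_real,
      Real.norm_of_nonneg (Real.rpow_nonneg hR0.le _)]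
    exact mul_le_mul_of_nonneg_left (norm_exp_airyPhase_polar_le x hR hθ.1.le hθ.2)
      (Real.rpow_nonneg hR0.le _)
  · have hint : ∫ θ in (0 : ℝ)..(Real.pi / 6), R ^ (γ + 1) * Real.exp (-R ^ 2 * θ) =
        R ^ (γ - 1) * (1 - Real.exp (-R ^ 2 * (Real.pi / 6))) := by
      rw [intervalIntegral.integral_eq_sub_of_hasDerivAt
        (f := fun θ => -R ^ (γ - 1) * Real.exp (-R ^ 2 * θ)) ?_ (hexp.intervalIntegrable _ _)]
      · simp; ring
      · intro θ _
        refine ((((hasDerivAt_id θ).const_mul (-R ^ 2)).exp).const_mul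
          (-R ^ (γ - 1))).congr_deriv ?_
        have := Real.rpow_add_natCast hR0.ne' (γ - 1) 2
        push_cast at this
        rw [show γ - 1 + 2 = γ + 1 by ring] at this
        rw [this, id_eq]
        ring
    rw [hint]
    refine mul_le_of_le_one_right (Real.rpow_nonneg hR0.le _) ?_
    linarith [Real.exp_pos (-R ^ 2 * (Real.pi / 6))]

/-- The primitive cube root of unity `e^{2πi/3}`. -/
noncomputable def cubeRootUnity : ℂ := Complex.exp ((2 * Real.pi / 3 : ℝ) * Complex.I)

/-- The angle π/6 is the one at which z³ = i r³, so that the oscillating cubic becomes exponential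
decay. -/
theorem exp_airyPhase_polar_pi_div_six (x r : ℝ) :
    Complex.exp (airyPhase x (polarPoint (Real.pi / 6) r)) =
      Complex.exp (-((r ^ 3 / 3 : ℝ) : ℂ) + cubeRootUnity * x * r) := by
  have h3 : Complex.exp ((Real.pi / 6 : ℝ) * Complex.I) ^ 3 = Complex.I := by
    nth_rewrite 2 [← Complex.exp_pi_div_two_mul_I]
    rw [← Complex.exp_nat_mul]
    congr 1
    push_cast
    ring
  have hw : cubeRootUnity = Complex.I * Complex.exp ((Real.pi / 6 : ℝ) * Complex.I) := by
    rw [cubeRootUnity]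
    nth_rewrite 2 [← Complex.exp_pi_div_two_mul_I]
    rw [← Complex.exp_add]
    congr 1
    push_cast
    ring
  congr 1
  rw [airyPhase, polarPoint, mul_pow, h3, hw]
  push_cast
  linear_combination ((r : ℂ) ^ 3 / 3) * Complex.I_sq

theorem tendsto_segmentIntegral {γ : ℝ} (hγ : -1 < γ) (hγ' : γ < 1) (x : ℝ) :
    Tendsto (fun R => segmentIntegral γ x R 0) atTop
      (nhds (Complex.exp ((γ + 1) * (Real.pi / 6 : ℝ) * Complex.I) *
        airyLaplace γ (cubeRootUnity * x))) := by
  have h1 : Tendsto (fun R => segmentIntegral γ x R (Real.pi / 6)) atTop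
      (nhds (Complex.exp ((γ + 1) * (Real.pi / 6 : ℝ) * Complex.I) *
        airyLaplace γ (cubeRootUnity * x))) := by
    unfold segmentIntegral
    refine Tendsto.const_mul _ ?_
    refine (intervalIntegral_tendsto_integral_Ioi 0
      (integrableOn_airyIntegrand hγ (cubeRootUnity * x)) tendsto_id).congr fun R => ?_
    simp only [exp_airyPhase_polar_pi_div_six, airyIntegrand, id]
  have h2 : Tendsto (fun R => segmentIntegral γ x R (Real.pi / 6) - segmentIntegral γ x R 0)
      atTop (nhds 0) := by
    refine squeeze_zero_norm' (a := fun R => R ^ (γ - 1)) ?_ ?_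
    · filter_upwards [eventually_ge_atTop (2 * |x| + 2)] with R hR
      exact norm_segmentIntegral_sub_le hγ x hR
    · have := tendsto_rpow_neg_atTop (y := 1 - γ) (by linarith)
      simpa using this
  simpa using h1.sub h2

/-- The coefficient relating `Ai_γ + i Gi_γ` to `airyLaplace`. -/
noncomputable def airyCoeff (γ : ℝ) : ℂ :=
  (1 / Real.pi : ℝ) * Complex.exp ((Real.pi / 6 - γ * Real.pi / 3 : ℝ) * Complex.I)

theorem tendsto_oscillatory {γ : ℝ} (hγ : -1 < γ) (hγ' : γ < 1) (x : ℝ) :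
    Tendsto (fun R : ℝ => ((1 / Real.pi : ℝ) : ℂ) * ∫ σ in (0 : ℝ)..R, ((σ ^ γ : ℝ) : ℂ) *
      Complex.exp ((σ ^ 3 / 3 + x * σ - γ * Real.pi / 2 : ℝ) * Complex.I)) atTop
      (nhds (airyCoeff γ * airyLaplace γ (cubeRootUnity * x))) := by
  have h := ((tendsto_segmentIntegral hγ hγ' x).const_mul
    (Complex.exp ((-γ * Real.pi / 2 : ℝ) * Complex.I))).const_mul ((1 / Real.pi : ℝ) : ℂ)
  -- The shift -γπ/2 and the rotation angle (γ+1)π/6 add up to π/6 - γπ/3.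
  have e : ((1 / Real.pi : ℝ) : ℂ) * (Complex.exp ((-γ * Real.pi / 2 : ℝ) * Complex.I) *
      (Complex.exp ((γ + 1) * (Real.pi / 6 : ℝ) * Complex.I) *
        airyLaplace γ (cubeRootUnity * x))) = airyCoeff γ * airyLaplace γ (cubeRootUnity * x) := by
    rw [airyCoeff, ← mul_assoc (Complex.exp _), ← Complex.exp_add, ← mul_assoc]
    congr 3
    push_cast
    ring
  rw [e] at h
  refine h.congr fun R => ?_
  congr 1
  rw [segmentIntegral, ← mul_assoc, ← intervalIntegral.integral_const_mul]
  refine intervalIntegral.integral_congr fun σ _ => ?_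
  simp only [Complex.ofReal_zero, mul_zero, zero_mul, Complex.exp_zero, mul_one, polarPoint]
  rw [mul_left_comm, ← Complex.exp_add]
  congr 2
  rw [airyPhase]
  push_cast
  ring

theorem intervalIntegrable_oscillatory {γ : ℝ} (hγ : -1 < γ) (x R : ℝ) :
    IntervalIntegrable (fun σ : ℝ => ((σ ^ γ : ℝ) : ℂ) *
      Complex.exp ((σ ^ 3 / 3 + x * σ - γ * Real.pi / 2 : ℝ) * Complex.I)) volume 0 R :=
  intervalIntegrable_rpow_mul hγ (by fun_prop) 0 R

theorem genAi_eq {γ : ℝ} (hγ : -1 < γ) (hγ' : γ < 1) (x : ℝ) :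
    genAi γ x = (airyCoeff γ * airyLaplace γ (cubeRootUnity * x)).re := by
  have h := (Complex.continuous_re.tendsto _).comp (tendsto_oscillatory hγ hγ' x)
  have h' := h.congr (f₂ := fun R : ℝ => 1 / Real.pi *
    ∫ σ in (0 : ℝ)..R, σ ^ γ * Real.cos (σ ^ 3 / 3 + x * σ - γ * Real.pi / 2)) fun R => by
      rw [Function.comp_apply, Complex.re_ofReal_mul]
      congr 1
      have := Complex.reCLM.intervalIntegral_comp_comm (intervalIntegrable_oscillatory hγ x R)
      rw [Complex.reCLM_apply] at this
      rw [← this]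
      refine intervalIntegral.integral_congr fun σ _ => ?_
      simp only [Complex.reCLM_apply, Complex.re_ofReal_mul, Complex.exp_ofReal_mul_I_re]
  have hpi := Real.pi_ne_zero
  -- Multiplying by π exposes the bare integral, whose convergence makes `limUnder` the true limit.
  have h'' := h'.const_mul Real.pi
  rw [genAi, Tendsto.limUnder_eq (h''.congr fun R => by
    rw [← mul_assoc, mul_one_div_cancel hpi, one_mul])]
  field_simp

theorem genGi_eq {γ : ℝ} (hγ : -1 < γ) (hγ' : γ < 1) (x : ℝ) :
    genGi γ x = (airyCoeff γ * airyLaplace γ (cubeRootUnity * x)).im := by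
  have h := (Complex.continuous_im.tendsto _).comp (tendsto_oscillatory hγ hγ' x)
  have h' := h.congr (f₂ := fun R : ℝ => 1 / Real.pi *
    ∫ σ in (0 : ℝ)..R, σ ^ γ * Real.sin (σ ^ 3 / 3 + x * σ - γ * Real.pi / 2)) fun R => by
      rw [Function.comp_apply, Complex.im_ofReal_mul]
      congr 1
      have := Complex.imCLM.intervalIntegral_comp_comm (intervalIntegrable_oscillatory hγ x R)
      rw [Complex.imCLM_apply] at this
      rw [← this]
      refine intervalIntegral.integral_congr fun σ _ => ?_
      simp only [Complex.imCLM_apply, Complex.im_ofReal_mul, Complex.exp_ofReal_mul_I_im]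
  have hpi := Real.pi_ne_zero
  have h'' := h'.const_mul Real.pi
  rw [genGi, Tendsto.limUnder_eq (h''.congr fun R => by
    rw [← mul_assoc, mul_one_div_cancel hpi, one_mul])]
  field_simp

theorem genHi_eq (γ x : ℝ) :
    genHi γ x = (((1 / Real.pi : ℝ) : ℂ) * airyLaplace γ (1 * x)).re := by
  rw [one_mul, airyLaplace_ofReal, ← Complex.ofReal_mul, Complex.ofReal_re, genHi]

/-! ### The three solutions of the homogeneous equation and their Wronskian relations -/

/-- The coefficients expressing `Ai_γ`, `Gi_γ`, `Hi_γ` as real parts of multiples of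
`airyLaplace`. -/
noncomputable def solCoeff (γ : ℝ) : Fin 3 → ℂ :=
  ![airyCoeff γ, -Complex.I * airyCoeff γ, ((1 / Real.pi : ℝ) : ℂ)]

/-- The cube roots of unity giving the directions of `Ai_γ`, `Gi_γ`, `Hi_γ`. -/
noncomputable def solDir : Fin 3 → ℂ := ![cubeRootUnity, cubeRootUnity, 1]

/-- The `k`-th derivatives of `Ai_γ`, `Gi_γ`, `Hi_γ`. -/
noncomputable def solJet (γ : ℝ) (i : Fin 3) (k : ℕ) (x : ℝ) : ℝ :=
  (solCoeff γ i * solDir i ^ k * airyLaplace (γ + k) (solDir i * x)).re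

theorem cubeRootUnity_pow_three : cubeRootUnity ^ 3 = 1 := by
  rw [cubeRootUnity, ← Complex.exp_nat_mul, ← Complex.exp_two_pi_mul_I]
  congr 1
  push_cast
  ring

theorem solDir_pow_three (i : Fin 3) : solDir i ^ 3 = 1 := by
  fin_cases i <;> simp [solDir, cubeRootUnity_pow_three]

theorem solJet_zero_eq_genAi {γ : ℝ} (hγ : -1 < γ) (hγ' : γ < 1) (x : ℝ) :
    solJet γ 0 0 x = genAi γ x := by
  simp [solJet, solCoeff, solDir, genAi_eq hγ hγ']

theorem solJet_one_eq_genGi {γ : ℝ} (hγ : -1 < γ) (hγ' : γ < 1) (x : ℝ) :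
    solJet γ 1 0 x = genGi γ x := by
  simp [solJet, solCoeff, solDir, genGi_eq hγ hγ']

theorem solJet_two_eq_genHi (γ x : ℝ) : solJet γ 2 0 x = genHi γ x := by
  rw [genHi_eq]
  simp [solJet, solCoeff, solDir]

theorem hasDerivAt_solJet {γ : ℝ} (hγ : -1 < γ) (i : Fin 3) (k : ℕ) (x : ℝ) :
    HasDerivAt (solJet γ i k) (solJet γ i (k + 1) x) x := by
  have hk : -1 < γ + k := by have := k.cast_nonneg (α := ℝ); linarith
  have h1 : HasDerivAt (fun x : ℝ => solDir i * (x : ℂ)) (solDir i) x := by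
    simpa using (hasDerivAt_id x).ofReal_comp.const_mul (solDir i)
  have h2 := ((hasDerivAt_airyLaplace hk (solDir i * x)).comp x h1).const_mul
    (solCoeff γ i * solDir i ^ k)
  refine (Complex.reCLM.hasFDerivAt.comp_hasDerivAt x h2).congr_deriv ?_
  rw [Complex.reCLM_apply, solJet]
  push_cast
  rw [add_assoc γ]
  ring_nf

theorem continuous_solJet {γ : ℝ} (hγ : -1 < γ) (i : Fin 3) (k : ℕ) :
    Continuous (solJet γ i k) :=
  continuous_iff_continuousAt.2 fun x => (hasDerivAt_solJet hγ i k x).continuousAt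

theorem solJet_three {γ : ℝ} (hγ : -1 < γ) (i : Fin 3) (x : ℝ) :
    solJet γ i 3 x = x * solJet γ i 1 x + (γ + 1) * solJet γ i 0 x := by
  have h : solCoeff γ i * solDir i ^ 3 * airyLaplace (γ + 3) (solDir i * x) =
      x * (solCoeff γ i * solDir i ^ 1 * airyLaplace (γ + 1) (solDir i * x)) +
        ((γ + 1 : ℝ) : ℂ) * (solCoeff γ i * solDir i ^ 0 * airyLaplace γ (solDir i * x)) := by
    rw [airyLaplace_add_three hγ, solDir_pow_three]
    push_cast
    ring
  have h' := congrArg Complex.re h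
  rw [Complex.add_re, Complex.re_ofReal_mul, Complex.re_ofReal_mul] at h'
  simpa only [solJet, Nat.cast_ofNat, Nat.cast_one, Nat.cast_zero, add_zero] using h'

theorem abs_solJet_le {γ : ℝ} (hγ : -1 < γ) (i : Fin 3) (k : ℕ) {x m : ℝ} (hm : 0 < m)
    (hx : (solDir i * x).re ≤ -m) :
    |solJet γ i k x| ≤
      ‖solCoeff γ i * solDir i ^ k‖ * Real.Gamma (γ + k + 1) * m ^ (-(1 + (γ + k))) := by
  have hk : -1 < γ + k := by have := k.cast_nonneg (α := ℝ); linarith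
  refine (Complex.abs_re_le_norm _).trans ?_
  rw [norm_mul, mul_assoc]
  exact mul_le_mul_of_nonneg_left (norm_airyLaplace_le hk hm hx) (norm_nonneg _)

theorem cubeRootUnity_re : cubeRootUnity.re = -(1 / 2) := by
  rw [cubeRootUnity, Complex.exp_ofReal_mul_I_re,
    show 2 * Real.pi / 3 = Real.pi - Real.pi / 3 by ring, Real.cos_pi_sub, Real.cos_pi_div_three]

/-- For x > 0 the point e^{2πi/3} x has real part -x/2, so the left half-plane bound applies. -/
theorem exists_solJet_bound_pos {γ : ℝ} (hγ : -1 < γ) {i : Fin 3} (hi : i ≠ 2) (k : ℕ) :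
    ∃ C, 0 ≤ C ∧ ∀ x : ℝ, 1 ≤ x → |solJet γ i k x| ≤ C * x ^ (-(1 + (γ + k))) := by
  have hk : 0 ≤ γ + k + 1 := by have := k.cast_nonneg (α := ℝ); linarith
  refine ⟨‖solCoeff γ i * solDir i ^ k‖ * Real.Gamma (γ + k + 1) * (1 / 2) ^ (-(1 + (γ + k))),
    mul_nonneg (mul_nonneg (norm_nonneg _) (Real.Gamma_nonneg_of_nonneg hk)) (by positivity),
    fun x hx => ?_⟩
  have hd : solDir i = cubeRootUnity := by
    fin_cases i <;> simp_all [solDir]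
  have h := abs_solJet_le hγ i k (x := x) (m := 1 / 2 * x) (by linarith)
    (by rw [hd, Complex.re_mul_ofReal, cubeRootUnity_re]; linarith)
  rwa [Real.mul_rpow (by norm_num) (by linarith), ← mul_assoc] at h

theorem exists_solJet_bound_neg {γ : ℝ} (hγ : -1 < γ) (k : ℕ) :
    ∃ C, 0 ≤ C ∧ ∀ x : ℝ, x ≤ -1 → |solJet γ 2 k x| ≤ C * (-x) ^ (-(1 + (γ + k))) := by
  have hk : 0 ≤ γ + k + 1 := by have := k.cast_nonneg (α := ℝ); linarith
  refine ⟨‖solCoeff γ 2 * solDir 2 ^ k‖ * Real.Gamma (γ + k + 1),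
    mul_nonneg (norm_nonneg _) (Real.Gamma_nonneg_of_nonneg hk), fun x hx => ?_⟩
  exact abs_solJet_le hγ 2 k (x := x) (m := -x) (by linarith) (by simp [solDir])

/-- The value at `0` of `airyLaplace`. -/
noncomputable def airyMoment (γ : ℝ) : ℝ :=
  (3 : ℝ) ^ ((γ - 2) / 3) * Real.Gamma ((γ + 1) / 3)

/-- The argument of the coefficient of `airyLaplace` in `Ai_γ^{(k)} + i Gi_γ^{(k)}`. -/
noncomputable def airyArg (γ : ℝ) (k : ℕ) : ℝ :=
  Real.pi / 6 - γ * Real.pi / 3 + k * (2 * Real.pi / 3)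

theorem airyCoeff_mul_pow (γ : ℝ) (k : ℕ) : airyCoeff γ * cubeRootUnity ^ k =
    ((1 / Real.pi : ℝ) : ℂ) * Complex.exp ((airyArg γ k : ℝ) * Complex.I) := by
  rw [airyCoeff, cubeRootUnity, ← Complex.exp_nat_mul, mul_assoc, ← Complex.exp_add, airyArg]
  congr 2
  push_cast
  ring

theorem solJet_at_zero {γ : ℝ} (hγ : -1 < γ) (i : Fin 3) (k : ℕ) :
    solJet γ i k 0 = airyMoment (γ + k) / Real.pi *
      ![Real.cos (airyArg γ k), Real.sin (airyArg γ k), 1] i := by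
  have hk : -1 < γ + k := by have := k.cast_nonneg (α := ℝ); linarith
  rw [solJet, Complex.ofReal_zero, mul_zero, airyLaplace_zero hk, Complex.re_mul_ofReal,
    airyMoment]
  fin_cases i
  · simp only [solCoeff, solDir, Fin.zero_eta, Matrix.cons_val_zero, airyCoeff_mul_pow,
      Complex.re_ofReal_mul, Complex.exp_ofReal_mul_I_re]
    ring
  · simp only [solCoeff, solDir, Fin.mk_one, Matrix.cons_val_one, mul_assoc, airyCoeff_mul_pow,
      Matrix.cons_val_zero]
    rw [neg_mul, Complex.neg_re, Complex.I_mul_re, Complex.im_ofReal_mul,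
      Complex.exp_ofReal_mul_I_im]
    ring
  · simp [solCoeff, solDir]
    ring

/-- The coefficient matrix of the kernel with respect to the three solutions. -/
noncomputable def kernelMatrix (γ : ℝ) : Matrix (Fin 3) (Fin 3) ℝ :=
  Real.pi • !![Real.sin (γ * Real.pi), -Real.cos (γ * Real.pi), 1;
    Real.cos (γ * Real.pi), Real.sin (γ * Real.pi), 0; 1, 0, 0]

/-- The Wronskian matrix of the three solutions. -/
noncomputable def wronskianMatrix (γ x : ℝ) : Matrix (Fin 3) (Fin 3) ℝ :=
  Matrix.of fun k i => solJet γ i k x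

/-- The matrix of the bilinear concomitant `u'' v - u' v' + u v'' - x u v`. -/
def concomitantMatrix (x : ℝ) : Matrix (Fin 3) (Fin 3) ℝ :=
  !![-x, 0, 1; 0, -1, 0; 1, 0, 0]

/-- Lagrange's identity: v of index -1-γ satisfies v''' = x v' - γ v, so the zero-order terms
(γ+1)uv and -γuv sum to uv and cancel against the derivative of the factor x in x u v. -/
theorem concomitant_const {γ : ℝ} (hγ : -1 < γ) (hγ' : γ < 0) (x : ℝ) :
    (wronskianMatrix γ x).transpose * concomitantMatrix x * wronskianMatrix (-1 - γ) x =
      (wronskianMatrix γ 0).transpose * concomitantMatrix 0 * wronskianMatrix (-1 - γ) 0 := by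
  ext i j
  have hν : -1 < -1 - γ := by linarith
  have key : ∀ x, ((wronskianMatrix γ x).transpose * concomitantMatrix x *
      wronskianMatrix (-1 - γ) x) i j = solJet γ i 2 x * solJet (-1 - γ) j 0 x -
        solJet γ i 1 x * solJet (-1 - γ) j 1 x + solJet γ i 0 x * solJet (-1 - γ) j 2 x -
        x * (solJet γ i 0 x * solJet (-1 - γ) j 0 x) := by
    intro x
    simp [Matrix.mul_apply, Fin.sum_univ_three, wronskianMatrix, concomitantMatrix]
    ring
  rw [key, key]
  have hd : ∀ x, HasDerivAt (fun x => solJet γ i 2 x * solJet (-1 - γ) j 0 x -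
        solJet γ i 1 x * solJet (-1 - γ) j 1 x + solJet γ i 0 x * solJet (-1 - γ) j 2 x -
        x * (solJet γ i 0 x * solJet (-1 - γ) j 0 x)) 0 x := by
    intro x
    have u := fun k => hasDerivAt_solJet hγ i k x
    have v := fun k => hasDerivAt_solJet hν j k x
    refine (((((u 2).fun_mul (v 0)).fun_sub ((u 1).fun_mul (v 1))).fun_add
      ((u 0).fun_mul (v 2))).fun_sub
        ((hasDerivAt_id x).fun_mul ((u 0).fun_mul (v 0)))).congr_deriv ?_
    simp only [id_eq, Nat.reduceAdd, zero_add, solJet_three hγ, solJet_three hν]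
    ring
  exact is_const_of_deriv_eq_zero (fun x => (hd x).differentiableAt) (fun x => (hd x).deriv) x 0

/-- For k + l = 2 the two Gamma arguments sum to 1, so the reflection formula applies. -/
theorem airyMoment_mul {γ : ℝ} {k l : ℕ} (h : k + l = 2) :
    airyMoment (γ + k) * airyMoment (-1 - γ + l) =
      Real.pi / (3 * Real.sin (γ * Real.pi / 3 + (k + 1) * (Real.pi / 3))) := by
  have hl : (l : ℝ) = 2 - k := by
    have : ((k + l : ℕ) : ℝ) = 2 := by rw [h]; norm_num
    push_cast at this
    linarith
  have e1 : (-1 - γ + (2 - k) + 1) / 3 = 1 - (γ + k + 1) / 3 := by ring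
  have e2 : (3 : ℝ) ^ ((γ + k - 2) / 3) * 3 ^ ((-1 - γ + (2 - k) - 2) / 3) = 1 / 3 := by
    rw [← Real.rpow_add (by norm_num),
      show (γ + k - 2) / 3 + (-1 - γ + (2 - k) - 2) / 3 = -1 by ring, Real.rpow_neg_one]
    norm_num
  have e3 := Real.Gamma_mul_Gamma_one_sub ((γ + k + 1) / 3)
  rw [airyMoment, airyMoment, hl, e1, mul_mul_mul_comm, e2, e3,
    show Real.pi * ((γ + k + 1) / 3) = γ * Real.pi / 3 + (k + 1) * (Real.pi / 3) by ring]
  ring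

theorem sin_add_third_pos {γ : ℝ} (hγ : -1 < γ) (hγ' : γ < 0) {k : ℕ} (hk : k ≤ 2) :
    0 < Real.sin (γ * Real.pi / 3 + (k + 1) * (Real.pi / 3)) := by
  have hpi := Real.pi_pos
  have h0 := k.cast_nonneg (α := ℝ)
  have h2 : (k : ℝ) ≤ 2 := by exact_mod_cast hk
  apply Real.sin_pos_of_pos_of_lt_pi
  · have : 0 < Real.pi / 3 * (γ + k + 1) := by apply mul_pos <;> linarith
    linarith
  · have : 0 < Real.pi / 3 * (2 - γ - k) := by apply mul_pos <;> linarith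
    linarith

/-- The right-hand side is the concomitant matrix at 0, which is its own inverse. Each entry is a
product of moments times a sum of three values from sin(g + π/3), sin(g - π/3), -sin g. Off the
antidiagonal all three occur once and cancel; on it one value occurs three times and meets the
reflection formula. -/
theorem wronskian_kernel_at_zero {γ : ℝ} (hγ : -1 < γ) (hγ' : γ < 0) :
    wronskianMatrix γ 0 * kernelMatrix γ * (wronskianMatrix (-1 - γ) 0).transpose =
      !![0, 0, 1; 0, -1, 0; 1, 0, 0] := by
  have hν : -1 < -1 - γ := by linarith
  have hpi := Real.pi_ne_zero
  have key : ∀ k l : Fin 3, (wronskianMatrix γ 0 * kernelMatrix γ *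
      (wronskianMatrix (-1 - γ) 0).transpose) k l =
      airyMoment (γ + (k : ℕ)) * airyMoment (-1 - γ + (l : ℕ)) / Real.pi *
        (Real.cos (airyArg γ k) + Real.cos (airyArg (-1 - γ) l) +
          Real.sin (γ * Real.pi + airyArg γ k - airyArg (-1 - γ) l)) := by
    intro k l
    rw [add_sub_assoc, Real.sin_add, Real.cos_sub, Real.sin_sub]
    simp [Matrix.mul_apply, Fin.sum_univ_three, wronskianMatrix, kernelMatrix, solJet_at_zero hγ,
      solJet_at_zero hν]
    field_simp
    ring
  set g := γ * Real.pi / 3 with hg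
  have hs : -Real.sin g + Real.sin (g + Real.pi / 3) + Real.sin (g - Real.pi / 3) = 0 := by
    rw [Real.sin_add, Real.sin_sub, Real.cos_pi_div_three]; ring
  have a0 : Real.cos (airyArg γ 0) = Real.sin (g + Real.pi / 3) := by
    rw [← Real.cos_pi_div_two_sub, airyArg, hg]; congr 1; push_cast; ring
  have a1 : Real.cos (airyArg γ 1) = Real.sin (g - Real.pi / 3) := by
    rw [← Real.cos_pi_div_two_sub, airyArg, hg]; congr 1; push_cast; ring
  have a2 : Real.cos (airyArg γ 2) = -Real.sin g := by
    rw [← Real.sin_sub_pi, ← Real.cos_pi_div_two_sub, airyArg, hg]; congr 1; push_cast; ring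
  have b0 : Real.cos (airyArg (-1 - γ) 0) = -Real.sin g := by
    rw [← Real.sin_sub_pi, ← Real.cos_pi_div_two_sub, ← Real.cos_two_pi_sub, airyArg, hg]
    congr 1; push_cast; ring
  have b1 : Real.cos (airyArg (-1 - γ) 1) = Real.sin (g - Real.pi / 3) := by
    rw [← Real.cos_pi_div_two_sub, ← Real.cos_two_pi_sub, airyArg, hg]; congr 1; push_cast; ring
  have b2 : Real.cos (airyArg (-1 - γ) 2) = Real.sin (g + Real.pi / 3) := by
    rw [← Real.cos_pi_div_two_sub, ← Real.cos_two_pi_sub, airyArg, hg]; congr 1; push_cast; ring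
  have t : ∀ k l : ℕ, γ * Real.pi + airyArg γ k - airyArg (-1 - γ) l =
      g - Real.pi / 3 + ((k : ℝ) - l) * (2 * Real.pi / 3) := by
    intro k l; rw [airyArg, airyArg, hg]; ring
  have t0 : ∀ k l : ℕ, k = l → Real.sin (γ * Real.pi + airyArg γ k - airyArg (-1 - γ) l) =
      Real.sin (g - Real.pi / 3) := by
    rintro k l rfl; rw [t]; congr 1; ring
  have t1 : ∀ k l : ℕ, k = l + 1 → Real.sin (γ * Real.pi + airyArg γ k - airyArg (-1 - γ) l) =
      Real.sin (g + Real.pi / 3) := by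
    rintro k l rfl; rw [t]; congr 1; push_cast; ring
  have t2 : ∀ k l : ℕ, k = l + 2 → Real.sin (γ * Real.pi + airyArg γ k - airyArg (-1 - γ) l) =
      -Real.sin g := by
    rintro k l rfl; rw [t, ← Real.sin_add_pi]; congr 1; push_cast; ring
  have t3 : ∀ k l : ℕ, l = k + 1 → Real.sin (γ * Real.pi + airyArg γ k - airyArg (-1 - γ) l) =
      -Real.sin g := by
    rintro k l rfl; rw [t, ← Real.sin_sub_pi]; congr 1; push_cast; ring
  have t4 : ∀ k l : ℕ, l = k + 2 → Real.sin (γ * Real.pi + airyArg γ k - airyArg (-1 - γ) l) =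
      Real.sin (g + Real.pi / 3) := by
    rintro k l rfl; rw [t, ← Real.sin_sub_two_pi (g + Real.pi / 3)]; congr 1; push_cast; ring
  have m0 := airyMoment_mul (γ := γ) (k := 0) (l := 2) rfl
  have m1 := airyMoment_mul (γ := γ) (k := 1) (l := 1) rfl
  have m2 := airyMoment_mul (γ := γ) (k := 2) (l := 0) rfl
  have p0 := (sin_add_third_pos hγ hγ' (k := 0) (by norm_num)).ne'
  have p1 := (sin_add_third_pos hγ hγ' (k := 1) (by norm_num)).ne'
  have p2 := (sin_add_third_pos hγ hγ' (k := 2) (by norm_num)).ne'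
  have q0 : Real.sin (g + ((0 : ℕ) + 1) * (Real.pi / 3)) = Real.sin (g + Real.pi / 3) := by
    congr 1; push_cast; ring
  have q1 : Real.sin (g + ((1 : ℕ) + 1) * (Real.pi / 3)) = -Real.sin (g - Real.pi / 3) := by
    rw [← Real.sin_add_pi]; congr 1; push_cast; ring
  have q2 : Real.sin (g + ((2 : ℕ) + 1) * (Real.pi / 3)) = -Real.sin g := by
    rw [← Real.sin_add_pi]; congr 1; push_cast; ring
  rw [← hg] at m0 m1 m2 p0 p1 p2
  rw [q0] at m0 p0
  rw [q1] at m1 p1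
  rw [q2] at m2 p2
  have off : ∀ {c s : ℝ}, s = 0 → c * s = 0 := fun h => by rw [h, mul_zero]
  ext k l
  rw [key]
  fin_cases k <;> fin_cases l
  · exact off (by simp only [a0, b0, t0 0 0 rfl]; linarith)
  · exact off (by simp only [a0, b1, t3 0 1 rfl]; linarith)
  · simp only [Fin.zero_eta, Fin.reduceFinMk]
    rw [m0, a0, b2, t4 0 2 rfl]
    simp only [Matrix.of_apply, Matrix.cons_val]
    generalize Real.sin (g + Real.pi / 3) = s at p0 ⊢
    field_simp
    ring
  · exact off (by simp only [a1, b0, t1 1 0 rfl]; linarith)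
  · simp only [Fin.mk_one]
    rw [m1, a1, b1, t0 1 1 rfl]
    simp only [Matrix.of_apply, Matrix.cons_val]
    generalize Real.sin (g - Real.pi / 3) = s at p1 ⊢
    have := neg_ne_zero.1 p1
    field_simp
    ring
  · exact off (by simp only [a1, b2, t3 1 2 rfl]; linarith)
  · simp only [Fin.zero_eta, Fin.reduceFinMk]
    rw [m2, a2, b0, t2 2 0 rfl]
    simp only [Matrix.of_apply, Matrix.cons_val]
    have := neg_ne_zero.1 p2
    field_simp
    ring
  · exact off (by simp only [a2, b1, t1 2 1 rfl]; linarith)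
  · exact off (by simp only [a2, b2, t0 2 2 rfl]; linarith)

/-- These are the jump conditions of a Green's function: continuity of the kernel and its first
x-derivative across the diagonal, and a unit jump of the second. -/
theorem sum_solJet_mul_kernel {γ : ℝ} (hγ : -1 < γ) (hγ' : γ < 0) (x : ℝ) (k : Fin 3) :
    ∑ i, solJet γ i k x * ∑ j, kernelMatrix γ i j * solJet (-1 - γ) j 0 x =
      if k = 2 then 1 else 0 := by
  set U := wronskianMatrix γ with hU
  set V := wronskianMatrix (-1 - γ) with hV
  set M := concomitantMatrix with hM
  have h0 : U 0 * (kernelMatrix γ * (V 0).transpose * (M 0).transpose) = 1 := by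
    rw [← mul_assoc, ← mul_assoc, wronskian_kernel_at_zero hγ hγ', hM, concomitantMatrix]
    ext i j
    fin_cases i <;> fin_cases j <;> simp [Matrix.mul_apply, Fin.sum_univ_three]
  have hB : ∀ x, kernelMatrix γ * (V x).transpose * (M x).transpose * U x =
      kernelMatrix γ * ((U x).transpose * M x * V x).transpose := by
    intro x
    simp only [Matrix.transpose_mul, Matrix.transpose_transpose, mul_assoc]
  -- A one-sided inverse of a square matrix is two-sided. Moving `U x` to the other side produces
  -- the constant concomitant, so the identity passes from 0 to every x.
  have hx : U x * (kernelMatrix γ * (V x).transpose * (M x).transpose) = 1 := by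
    rw [mul_eq_one_comm, hB, concomitant_const hγ hγ', ← hB, mul_eq_one_comm, h0]
  -- The last row of the concomitant matrix is (1, 0, 0), so this column involves only the
  -- undifferentiated adjoint solutions.
  have hk := congrFun (congrFun hx k) 2
  rw [Matrix.one_apply] at hk
  rw [← hk, ← mul_assoc, ← mul_assoc]
  simp [Matrix.mul_apply, Fin.sum_univ_three, hU, hV, hM, wronskianMatrix, concomitantMatrix]
  ring

/-! ### The solution given by the kernel -/

theorem hasDerivAt_integral_Iic {g : ℝ → ℝ} (hg : Continuous g) (hi : Integrable g) (x : ℝ) :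
    HasDerivAt (fun x => ∫ y in Set.Iic x, g y) (g x) x := by
  have h := ((hg.integral_hasStrictDerivAt 0 x).hasDerivAt).add_const (∫ y in Set.Iic 0, g y)
  refine h.congr_of_eventuallyEq (Eventually.of_forall fun u => ?_)
  dsimp only
  rw [← intervalIntegral.integral_Iic_sub_Iic hi.integrableOn hi.integrableOn, sub_add_cancel]

theorem hasDerivAt_integral_Ioi {g : ℝ → ℝ} (hg : Continuous g) (hi : Integrable g) (x : ℝ) :
    HasDerivAt (fun x => ∫ y in Set.Ioi x, g y) (-g x) x := by
  have h := (hasDerivAt_integral_Iic hg hi x).const_sub (∫ y, g y)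
  refine h.congr_of_eventuallyEq (Eventually.of_forall fun u => ?_)
  dsimp only
  rw [← intervalIntegral.integral_Iic_add_Ioi hi.integrableOn hi.integrableOn,
    add_sub_cancel_left]

/-- The solutions of the adjoint equation paired with `Ai_γ`, `Gi_γ`, `Hi_γ` in the kernel. -/
noncomputable def dualSol (γ : ℝ) (i : Fin 3) (y : ℝ) : ℝ :=
  ∑ j, kernelMatrix γ i j * solJet (-1 - γ) j 0 y

theorem continuous_dualSol {γ : ℝ} (hγ : γ < 0) (i : Fin 3) : Continuous (dualSol γ i) :=
  continuous_finsetSum _ fun j _ =>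
    (continuous_solJet (by linarith : -1 < -1 - γ) j 0).const_mul _

theorem sum_solJet_mul_dualSol {γ : ℝ} (hγ : -1 < γ) (hγ' : γ < 0) (x : ℝ) (k : Fin 3) :
    ∑ i, solJet γ i k x * dualSol γ i x = if k = 2 then 1 else 0 :=
  sum_solJet_mul_kernel hγ hγ' x k

/-- The coefficients in the method of variation of constants. -/
noncomputable def greenWeight (γ : ℝ) (f : ℝ → ℝ) (i : Fin 3) (x : ℝ) : ℝ :=
  if i = 2 then ∫ y in Set.Ioi x, dualSol γ i y * f y
  else -∫ y in Set.Iic x, dualSol γ i y * f y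

/-- The sums `∑ u_i^{(k)} w_i`, which are the derivatives up to order two of the solution given by
the kernel. -/
noncomputable def greenJet (γ : ℝ) (f : ℝ → ℝ) (k : ℕ) (x : ℝ) : ℝ :=
  ∑ i, solJet γ i k x * greenWeight γ f i x

section

variable {γ : ℝ} {f : ℝ → ℝ}

theorem continuous_dualSol_mul (hγ' : γ < 0) (hf : Continuous f) (i : Fin 3) :
    Continuous fun y => dualSol γ i y * f y :=
  (continuous_dualSol hγ' i).mul hf

theorem integrable_dualSol_mul (hγ' : γ < 0) (hf : Continuous f) (hs : HasCompactSupport f)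
    (i : Fin 3) : Integrable fun y => dualSol γ i y * f y :=
  (continuous_dualSol_mul hγ' hf i).integrable_of_hasCompactSupport hs.mul_left

theorem hasDerivAt_greenWeight (hγ' : γ < 0) (hf : Continuous f) (hs : HasCompactSupport f)
    (i : Fin 3) (x : ℝ) :
    HasDerivAt (greenWeight γ f i) (-(dualSol γ i x * f x)) x := by
  have hg := continuous_dualSol_mul hγ' hf i
  have hi := integrable_dualSol_mul hγ' hf hs i
  unfold greenWeight
  split_ifs with h
  · exact hasDerivAt_integral_Ioi hg hi x
  · exact (hasDerivAt_integral_Iic hg hi x).fun_neg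

/-- Differentiating the weights produces the jump sums times -f, which vanish for k < 2 and equal -f
for k = 2. -/
theorem hasDerivAt_greenJet_aux (hγ : -1 < γ) (hγ' : γ < 0) (hf : Continuous f)
    (hs : HasCompactSupport f) (k : Fin 3) (x : ℝ) :
    HasDerivAt (greenJet γ f k) (greenJet γ f (k + 1) x - (if k = 2 then f x else 0)) x := by
  have h : HasDerivAt (greenJet γ f k) (∑ i, (solJet γ i (k + 1) x * greenWeight γ f i x +
      solJet γ i k x * -(dualSol γ i x * f x))) x :=
    HasDerivAt.fun_sum fun i _ =>
      (hasDerivAt_solJet hγ i k x).fun_mul (hasDerivAt_greenWeight hγ' hf hs i x)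
  refine h.congr_deriv ?_
  have e : (if k = 2 then f x else 0) = (∑ i, solJet γ i k x * dualSol γ i x) * f x := by
    rw [sum_solJet_mul_dualSol hγ hγ']
    split_ifs <;> simp
  rw [e, Finset.sum_add_distrib, sub_eq_add_neg, greenJet, Finset.sum_mul,
    ← Finset.sum_neg_distrib]
  congr 1
  exact Finset.sum_congr rfl fun i _ => by ring

theorem hasDerivAt_greenJet_zero (hγ : -1 < γ) (hγ' : γ < 0) (hf : Continuous f)
    (hs : HasCompactSupport f) (x : ℝ) :
    HasDerivAt (greenJet γ f 0) (greenJet γ f 1 x) x := by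
  simpa using hasDerivAt_greenJet_aux hγ hγ' hf hs 0 x

theorem hasDerivAt_greenJet_one (hγ : -1 < γ) (hγ' : γ < 0) (hf : Continuous f)
    (hs : HasCompactSupport f) (x : ℝ) :
    HasDerivAt (greenJet γ f 1) (greenJet γ f 2 x) x := by
  simpa using hasDerivAt_greenJet_aux hγ hγ' hf hs 1 x

theorem hasDerivAt_greenJet_two (hγ : -1 < γ) (hγ' : γ < 0) (hf : Continuous f)
    (hs : HasCompactSupport f) (x : ℝ) :
    HasDerivAt (greenJet γ f 2)
      (x * greenJet γ f 1 x + (γ + 1) * greenJet γ f 0 x - f x) x := by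
  refine (hasDerivAt_greenJet_aux hγ hγ' hf hs 2 x).congr_deriv ?_
  have : greenJet γ f 3 x = x * greenJet γ f 1 x + (γ + 1) * greenJet γ f 0 x := by
    simp only [greenJet, solJet_three hγ, Finset.mul_sum, ← Finset.sum_add_distrib]
    exact Finset.sum_congr rfl fun i _ => by ring
  simp [this]

theorem deriv_greenJet_zero (hγ : -1 < γ) (hγ' : γ < 0) (hf : Continuous f)
    (hs : HasCompactSupport f) : deriv (greenJet γ f 0) = greenJet γ f 1 :=
  funext fun x => (hasDerivAt_greenJet_zero hγ hγ' hf hs x).deriv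

theorem iteratedDeriv_three_greenJet (hγ : -1 < γ) (hγ' : γ < 0) (hf : Continuous f)
    (hs : HasCompactSupport f) : iteratedDeriv 3 (greenJet γ f 0) =
      fun x => x * greenJet γ f 1 x + (γ + 1) * greenJet γ f 0 x - f x := by
  rw [iteratedDeriv_succ, iteratedDeriv_succ, iteratedDeriv_one, deriv_greenJet_zero hγ hγ' hf hs,
    funext fun x => (hasDerivAt_greenJet_one hγ hγ' hf hs x).deriv]
  exact funext fun x => (hasDerivAt_greenJet_two hγ hγ' hf hs x).deriv

theorem contDiff_greenJet (hγ : -1 < γ) (hγ' : γ < 0) (hf : Continuous f)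
    (hs : HasCompactSupport f) : ContDiff ℝ 3 (greenJet γ f 0) := by
  have d0 := hasDerivAt_greenJet_zero hγ hγ' hf hs
  have d1 := hasDerivAt_greenJet_one hγ hγ' hf hs
  have d2 := hasDerivAt_greenJet_two hγ hγ' hf hs
  have c0 : Continuous (greenJet γ f 0) :=
    continuous_iff_continuousAt.2 fun x => (d0 x).continuousAt
  have c1 : Continuous (greenJet γ f 1) :=
    continuous_iff_continuousAt.2 fun x => (d1 x).continuousAt
  have e2 : ContDiff ℝ 1 (greenJet γ f 2) := by
    rw [contDiff_one_iff_deriv, funext fun x => (d2 x).deriv]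
    exact ⟨fun x => (d2 x).differentiableAt, by fun_prop⟩
  have e1 : ContDiff ℝ (1 + 1) (greenJet γ f 1) := by
    rw [contDiff_succ_iff_deriv, funext fun x => (d1 x).deriv]
    exact ⟨fun x => (d1 x).differentiableAt, by simp, e2⟩
  have e0 : ContDiff ℝ (1 + 1 + 1) (greenJet γ f 0) := by
    rw [contDiff_succ_iff_deriv, funext fun x => (d0 x).deriv]
    refine ⟨fun x => (d0 x).differentiableAt, fun h => ?_, e1⟩
    exact absurd h (by decide)
  exact e0.of_le (by norm_num)

theorem opL_greenJet (hγ : -1 < γ) (hγ' : γ < 0) (hf : Continuous f)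
    (hs : HasCompactSupport f) (x : ℝ) : opL γ (greenJet γ f 0) x = f x := by
  rw [opL, iteratedDeriv_three_greenJet hγ hγ' hf hs, deriv_greenJet_zero hγ hγ' hf hs]
  ring

theorem greenKernel_mul_eq (hγ : -1 < γ) (hγ' : γ < 0) (x y : ℝ) :
    greenKernel γ x y * f y =
      (Set.Ioi x).indicator (fun y => solJet γ 2 0 x * (dualSol γ 2 y * f y)) y -
      (Set.Iio x).indicator (fun y => solJet γ 0 0 x * (dualSol γ 0 y * f y) +
        solJet γ 1 0 x * (dualSol γ 1 y * f y)) y := by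
  have hν : -1 < -1 - γ := by linarith
  simp only [dualSol, Fin.sum_univ_three, solJet_zero_eq_genAi hγ (by linarith),
    solJet_one_eq_genGi hγ (by linarith), solJet_two_eq_genHi, kernelMatrix,
    solJet_zero_eq_genAi hν (by linarith), solJet_one_eq_genGi hν (by linarith), greenKernel]
  rcases lt_trichotomy x y with h | rfl | h
  · simp [h, h.not_gt, Set.indicator]
    ring
  · simp
  · simp [h, h.not_gt, Set.indicator]
    ring

theorem integrable_greenKernel_mul (hγ : -1 < γ) (hγ' : γ < 0) (hf : Continuous f)
    (hs : HasCompactSupport f) (x : ℝ) : Integrable fun y => greenKernel γ x y * f y := by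
  simp only [greenKernel_mul_eq hγ hγ']
  have h := fun i => integrable_dualSol_mul (γ := γ) hγ' hf hs i
  exact (((h 2).const_mul _).indicator measurableSet_Ioi).sub
    ((((h 0).const_mul _).add ((h 1).const_mul _)).indicator measurableSet_Iio)

theorem greenJet_eq_integral (hγ : -1 < γ) (hγ' : γ < 0) (hf : Continuous f)
    (hs : HasCompactSupport f) (x : ℝ) :
    greenJet γ f 0 x = ∫ y, greenKernel γ x y * f y := by
  have h := fun i => integrable_dualSol_mul (γ := γ) hγ' hf hs i
  simp only [greenKernel_mul_eq hγ hγ']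
  rw [integral_sub (((h 2).const_mul _).indicator measurableSet_Ioi)
    ((((h 0).const_mul _).fun_add ((h 1).const_mul _)).indicator measurableSet_Iio),
    integral_indicator measurableSet_Ioi, integral_indicator measurableSet_Iio,
    integral_add ((h 0).const_mul _).integrableOn ((h 1).const_mul _).integrableOn,
    integral_const_mul, integral_const_mul, integral_const_mul, ← integral_Iic_eq_integral_Iio,
    ← integral_Iic_eq_integral_Iio]
  simp [greenJet, greenWeight, Fin.sum_univ_three]
  ring

/-! ### Decay of the solution and membership in X_0 -/

theorem abs_greenWeight_le (hγ' : γ < 0) (hf : Continuous f) (hs : HasCompactSupport f)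
    (i : Fin 3) (x : ℝ) : |greenWeight γ f i x| ≤ ∫ y, |dualSol γ i y * f y| := by
  have h := integrable_dualSol_mul (γ := γ) hγ' hf hs i
  unfold greenWeight
  split_ifs
  · exact (abs_integral_le_integral_abs).trans
      (setIntegral_le_integral h.abs (Eventually.of_forall fun _ => abs_nonneg _))
  · rw [abs_neg]
    exact (abs_integral_le_integral_abs).trans
      (setIntegral_le_integral h.abs (Eventually.of_forall fun _ => abs_nonneg _))

/-- Beyond the support of f the weights of the solutions not known to decay there are integrals of
zero. -/
theorem exists_greenWeight_eq_zero (hs : HasCompactSupport f) :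
    ∃ M : ℝ, 1 ≤ M ∧ (∀ x, M ≤ x → greenWeight γ f 2 x = 0) ∧
      ∀ i, i ≠ 2 → ∀ x, x ≤ -M → greenWeight γ f i x = 0 := by
  obtain ⟨R, hR⟩ := hs.isCompact.isBounded.subset_closedBall 0
  have h0 : ∀ y, R < |y| → f y = 0 := fun y hy => by
    refine image_eq_zero_of_notMem_tsupport fun hm => ?_
    have := hR hm
    rw [Metric.mem_closedBall, dist_zero_right, Real.norm_eq_abs] at this
    linarith
  refine ⟨max 1 (R + 1), le_max_left _ _, fun x hx => ?_, fun i hi x hx => ?_⟩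
  · rw [greenWeight, if_pos rfl]
    refine setIntegral_eq_zero_of_forall_eq_zero fun y hy => ?_
    have hy' : x < y := hy
    rw [h0 y, mul_zero]
    linarith [le_max_right 1 (R + 1), le_abs_self y]
  · rw [greenWeight, if_neg hi, neg_eq_zero]
    refine setIntegral_eq_zero_of_forall_eq_zero fun y hy => ?_
    have hy' : y ≤ x := hy
    rw [h0 y, mul_zero]
    linarith [le_max_right 1 (R + 1), neg_le_abs y]

/-- Compactness handles |x| ≤ M; beyond, 1 + |x| ≤ 2|x| costs the factor 2^a. -/
theorem exists_weighted_bound {u : ℝ → ℝ} (hu : Continuous u) {a C M : ℝ} (ha : 0 ≤ a)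
    (hM : 1 ≤ M) (h : ∀ x, M ≤ |x| → |u x| ≤ C * |x| ^ (-a)) :
    ∃ D, ∀ x, (1 + |x|) ^ a * |u x| ≤ D := by
  have hc : Continuous fun x : ℝ => (1 + |x|) ^ a * |u x| := by
    refine Continuous.mul ?_ hu.abs
    exact (Real.continuous_rpow_const ha).comp (by fun_prop)
  obtain ⟨B, hB⟩ := (isCompact_Icc (a := -M) (b := M)).bddAbove_image hc.continuousOn
  refine ⟨max B (2 ^ a * C), fun x => ?_⟩
  rcases le_total M |x| with hx | hx
  · refine le_trans ?_ (le_max_right _ _)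
    have hx0 : 0 < |x| := by linarith
    have h1 : (1 + |x|) ^ a ≤ (2 * |x|) ^ a :=
      Real.rpow_le_rpow (by positivity) (by linarith) ha
    refine (mul_le_mul h1 (h x hx) (abs_nonneg _) (by positivity)).trans (le_of_eq ?_)
    rw [Real.mul_rpow (by norm_num) hx0.le, Real.rpow_neg hx0.le]
    have := (Real.rpow_pos_of_pos hx0 a).ne'
    field_simp
  · exact (hB ⟨x, abs_le.1 hx, rfl⟩).trans (le_max_left _ _)

theorem exists_greenJet_bound (hγ : -1 < γ) (hγ' : γ < 0) (hf : Continuous f)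
    (hs : HasCompactSupport f) (k : ℕ) (hk : Continuous (greenJet γ f k)) :
    ∃ D, ∀ x, (1 + |x|) ^ (1 + (γ + k)) * |greenJet γ f k x| ≤ D := by
  have hk0 := k.cast_nonneg (α := ℝ)
  obtain ⟨M, hM, hz, hz'⟩ := exists_greenWeight_eq_zero (γ := γ) hs
  obtain ⟨C0, h0, H0⟩ := exists_solJet_bound_pos hγ (i := 0) (by decide) k
  obtain ⟨C1, h1, H1⟩ := exists_solJet_bound_pos hγ (i := 1) (by decide) k
  obtain ⟨C2, h2, H2⟩ := exists_solJet_bound_neg hγ k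
  have W := abs_greenWeight_le (γ := γ) hγ' hf hs
  have Wp : ∀ i, 0 ≤ ∫ y, |dualSol γ i y * f y| := fun i =>
    integral_nonneg fun _ => abs_nonneg _
  set B : Fin 3 → ℝ := fun i => ∫ y, |dualSol γ i y * f y| with hB
  have q0 := mul_nonneg h0 (Wp 0)
  have q1 := mul_nonneg h1 (Wp 1)
  have q2 := mul_nonneg h2 (Wp 2)
  refine exists_weighted_bound hk (C := C0 * B 0 + C1 * B 1 + C2 * B 2) (by linarith)
    hM fun x hx => ?_
  have hp : 0 ≤ |x| ^ (-(1 + (γ + k))) := by positivity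
  rcases le_total 0 x with hx0 | hx0
  · rw [abs_of_nonneg hx0] at hx hp ⊢
    have e : greenJet γ f k x =
        solJet γ 0 k x * greenWeight γ f 0 x + solJet γ 1 k x * greenWeight γ f 1 x := by
      rw [greenJet, Fin.sum_univ_three, hz x hx, mul_zero, add_zero]
    rw [e]
    refine (abs_add_le _ _).trans ?_
    rw [abs_mul, abs_mul]
    have a0 := mul_le_mul (H0 x (hM.trans hx)) (W 0 x) (abs_nonneg _) (mul_nonneg h0 hp)
    have a1 := mul_le_mul (H1 x (hM.trans hx)) (W 1 x) (abs_nonneg _) (mul_nonneg h1 hp)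
    have := mul_nonneg q2 hp
    simp only [hB]
    linarith
  · rw [abs_of_nonpos hx0] at hx hp ⊢
    have e : greenJet γ f k x = solJet γ 2 k x * greenWeight γ f 2 x := by
      rw [greenJet, Fin.sum_univ_three, hz' 0 (by decide) x (by linarith),
        hz' 1 (by decide) x (by linarith)]
      ring
    rw [e, abs_mul]
    have a0 := mul_le_mul (H2 x (by linarith)) (W 2 x) (abs_nonneg _) (mul_nonneg h2 hp)
    have := mul_nonneg q0 hp
    have := mul_nonneg q1 hp
    simp only [hB]
    linarith

theorem greenJet_mem_spaceX (hγ : -1 < γ) (hγ' : γ < 0) (hf : Continuous f)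
    (hs : HasCompactSupport f) : greenJet γ f 0 ∈ spaceX γ := by
  have hc := contDiff_greenJet hγ hγ' hf hs
  obtain ⟨D0, h0⟩ := exists_greenJet_bound hγ hγ' hf hs 0 hc.continuous
  obtain ⟨D1, h1⟩ := exists_greenJet_bound hγ hγ' hf hs 1
    (continuous_iff_continuousAt.2 fun x => (hasDerivAt_greenJet_one hγ hγ' hf hs x).continuousAt)
  refine ⟨hc.of_le (by norm_num), D0 + D1, ?_⟩
  rintro _ ⟨x, rfl⟩
  have e0 : 1 + (γ + ((0 : ℕ) : ℝ)) = 1 + γ := by push_cast; ring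
  have e1 : 1 + (γ + ((1 : ℕ) : ℝ)) = 2 + γ := by push_cast; ring
  have := h0 x
  have := h1 x
  rw [e0] at *
  rw [e1] at *
  dsimp only
  rw [deriv_greenJet_zero hγ hγ' hf hs]
  linarith

end

/-! ### The weak form of the equation -/

theorem contDiff_of_jet {J : ℕ → ℝ → ℝ} (hJ : ∀ k x, HasDerivAt (J k) (J (k + 1) x) x) (k : ℕ) :
    ContDiff ℝ ∞ (J k) := by
  refine contDiff_infty.2 fun n => ?_
  induction n generalizing k with
  | zero =>
    exact contDiff_zero.2 (continuous_iff_continuousAt.2 fun x => (hJ k x).continuousAt)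
  | succ n ih =>
    rw [Nat.cast_add, Nat.cast_one, contDiff_succ_iff_deriv, funext fun x => (hJ k x).deriv]
    refine ⟨fun x => (hJ k x).differentiableAt, fun h => ?_, ih (k + 1)⟩
    exact absurd h (by simp)

theorem adjoint_expr_eq {γ : ℝ} {φ φ₁ φ₂ φ₃ : ℝ → ℝ} (h₁ : ∀ x, HasDerivAt φ (φ₁ x) x)
    (h₂ : ∀ x, HasDerivAt φ₁ (φ₂ x) x) (h₃ : ∀ x, HasDerivAt φ₂ (φ₃ x) x) (x : ℝ) :
    (1 + γ) * φ x - deriv (fun t => t * φ t) x + iteratedDeriv 3 φ x =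
      γ * φ x - x * φ₁ x + φ₃ x := by
  have e : deriv (fun t => t * φ t) x = φ x + x * φ₁ x := by
    refine ((hasDerivAt_id x).fun_mul (h₁ x)).deriv.trans ?_
    simp
  rw [e, iteratedDeriv_succ, iteratedDeriv_succ, iteratedDeriv_one, funext fun x => (h₁ x).deriv,
    funext fun x => (h₂ x).deriv, (h₃ x).deriv]
  ring

theorem weakEqL_of_hasDerivAt {γ : ℝ} {u u₁ u₂ f : ℝ → ℝ} (hf : Continuous f)
    (h₁ : ∀ x, HasDerivAt u (u₁ x) x) (h₂ : ∀ x, HasDerivAt u₁ (u₂ x) x)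
    (h₃ : ∀ x, HasDerivAt u₂ (x * u₁ x + (γ + 1) * u x - f x) x) : WeakEqL γ u f := by
  intro φ hφ hs
  have c0 : Continuous u := continuous_iff_continuousAt.2 fun x => (h₁ x).continuousAt
  have c1 : Continuous u₁ := continuous_iff_continuousAt.2 fun x => (h₂ x).continuousAt
  have c2 : Continuous u₂ := continuous_iff_continuousAt.2 fun x => (h₃ x).continuousAt
  have s1 := contDiff_infty_iff_deriv.1 hφ
  have s2 := contDiff_infty_iff_deriv.1 s1.2
  have s3 := contDiff_infty_iff_deriv.1 s2.2
  have d1 := fun x => (s1.1 x).hasDerivAt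
  have d2 := fun x => (s2.1 x).hasDerivAt
  have d3 := fun x => (s3.1 x).hasDerivAt
  set φ₁ := deriv φ
  set φ₂ := deriv φ₁
  set φ₃ := deriv φ₂
  have k1 : HasCompactSupport φ₁ := hs.deriv
  have k2 : HasCompactSupport φ₂ := k1.deriv
  have k3 : HasCompactSupport φ₃ := k2.deriv
  have e0 := hφ.continuous
  have e1 := s1.2.continuous
  have e2 := s2.2.continuous
  have e3 := s3.2.continuous
  simp only [adjoint_expr_eq d1 d2 d3]
  have hfφ : Integrable fun x => f x * φ x :=
    (hf.mul e0).integrable_of_hasCompactSupport hs.mul_left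
  have hlhs : Integrable fun x => u x * (γ * φ x - x * φ₁ x + φ₃ x) :=
    (c0.mul (by fun_prop)).integrable_of_hasCompactSupport
      (((hs.mul_left).sub k1.mul_left).add k3).mul_left
  have hB : Integrable fun x => u₂ x * φ x - u₁ x * φ₁ x + u x * φ₂ x - x * u x * φ x :=
    Continuous.integrable_of_hasCompactSupport (by fun_prop)
      ((((hs.mul_left).sub k1.mul_left).add k2.mul_left).sub hs.mul_left)
  -- The integrand is the derivative of the compactly supported concomitant u''φ - u'φ' + uφ'' -
  -- xuφ.
  have key := integral_eq_zero_of_hasDerivAt_of_integrable (f' := fun x =>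
    u x * (γ * φ x - x * φ₁ x + φ₃ x) - f x * φ x) (fun x => ?_) (hlhs.sub hfφ) hB
  · rwa [integral_sub hlhs hfφ, sub_eq_zero] at key
  · refine (((((h₃ x).fun_mul (d1 x)).fun_sub ((h₂ x).fun_mul (d2 x))).fun_add
      ((h₁ x).fun_mul (d3 x))).fun_sub
        (((hasDerivAt_id x).fun_mul (h₁ x)).fun_mul (d1 x))).congr_deriv ?_
    simp only [id_eq]
    ring

/-! ### Cut-off functions -/

theorem exists_cutoff_jet : ∃ χ : ℕ → ℝ → ℝ, (∀ k x, HasDerivAt (χ k) (χ (k + 1) x) x) ∧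
    (∀ k, HasCompactSupport (χ k)) ∧ χ 0 0 = 1 ∧ ∀ x, |χ 0 x| ≤ 1 := by
  let b : ContDiffBump (0 : ℝ) := ⟨1, 2, one_pos, one_lt_two⟩
  have hb : ContDiff ℝ ∞ b := b.contDiff
  refine ⟨fun k => iteratedDeriv k b, fun k x => ?_, fun k => ?_, ?_, fun x => ?_⟩
  · dsimp only
    rw [iteratedDeriv_succ]
    exact ((hb.differentiable_iteratedDeriv k (by exact_mod_cast WithTop.coe_lt_top k))
      x).hasDerivAt
  · induction k with
    | zero => simpa using b.hasCompactSupport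
    | succ k ih => simpa only [iteratedDeriv_succ] using ih.deriv
  · dsimp only
    rw [iteratedDeriv_zero]
    exact b.one_of_mem_closedBall (by simp [b])
  · dsimp only
    rw [iteratedDeriv_zero, abs_of_nonneg b.nonneg]
    exact b.le_one

theorem hasCompactSupport_comp_div {g : ℝ → ℝ} (hg : HasCompactSupport g) {R : ℝ} (hR : R ≠ 0) :
    HasCompactSupport fun x => g (x / R) := by
  simpa [div_eq_mul_inv, Function.comp_def] using hg.comp_homeomorph (Homeomorph.mulRight₀ R⁻¹ (inv_ne_zero hR))

/-- The substitution x = Ry gives ∫ g(y) v(Ry) dy, with v bounded and v(Ry) → 0 for y ≠ 0. Only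
decay of v is used, which matters because the X_0 bound on u does not make u integrable. -/
theorem tendsto_integral_cutoff_deriv {g v : ℝ → ℝ} (hg : Continuous g)
    (hgs : HasCompactSupport g) (hv : Continuous v) (hv0 : Tendsto v (cocompact ℝ) (nhds 0)) :
    Tendsto (fun R : ℝ => ∫ x, R⁻¹ * g (x / R) * v x) atTop (nhds 0) := by
  have hsub : ∀ᶠ R : ℝ in atTop, ∫ y, g y * v (R * y) = ∫ x, R⁻¹ * g (x / R) * v x := by
    filter_upwards [eventually_gt_atTop 0] with R hR
    have h := Measure.integral_comp_div (fun y => g y * v (R * y)) R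
    rw [abs_of_pos hR, smul_eq_mul] at h
    have h' : ∀ x, R⁻¹ * g (x / R) * v x = R⁻¹ * (g (x / R) * v (R * (x / R))) := fun x => by
      rw [mul_div_cancel₀ _ hR.ne', mul_assoc]
    simp only [h']
    rw [integral_const_mul, h, inv_mul_cancel_left₀ hR.ne']
  refine Tendsto.congr' hsub ?_
  obtain ⟨C, hC⟩ : ∃ C, ∀ x, ‖v x‖ ≤ C :=
    ⟨_, (⟨⟨v, hv⟩, hv0⟩ : ZeroAtInftyContinuousMap ℝ ℝ).toBCF.norm_coe_le_norm⟩
  rw [show (0 : ℝ) = ∫ _ : ℝ, (0 : ℝ) by simp]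
  refine tendsto_integral_filter_of_dominated_convergence (fun y => |g y| * C) ?_ ?_ ?_ ?_
  · exact Eventually.of_forall fun R => (by fun_prop : Continuous _).aestronglyMeasurable
  · refine Eventually.of_forall fun R => Eventually.of_forall fun y => ?_
    rw [norm_mul]
    exact mul_le_mul_of_nonneg_left (hC _) (abs_nonneg _)
  · exact ((hg.integrable_of_hasCompactSupport hgs).abs).mul_const C
  · have h0 : ∀ᵐ y : ℝ, y ≠ 0 := by simp [ae_iff]
    filter_upwards [h0] with y hy
    have h1 : Tendsto (fun R : ℝ => R * y) atTop (cocompact ℝ) := by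
      have h2 : Tendsto (fun R : ℝ => R * y) (cocompact ℝ) (cocompact ℝ) :=
        (Homeomorph.mulRight₀ y hy).isClosedEmbedding.tendsto_cocompact
      exact h2.mono_left atTop_le_cocompact
    simpa using (hv0.comp h1).const_mul (g y)

/-! ### Oscillatory test functions -/

/-- The phase `s³/3 + x s + θ`. -/
noncomputable def oscPhase (θ x s : ℝ) : ℝ := s ^ 3 / 3 + x * s + θ

/-- The derivatives of `x ↦ ∫_a^b s^{-γ-1} cos (s³/3 + x s + θ) ds`. -/
noncomputable def oscJet (γ θ a b : ℝ) (n : ℕ) (x : ℝ) : ℝ :=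
  ∫ s in a..b, s ^ (n - γ - 1) * Real.cos (oscPhase θ x s + n * (Real.pi / 2))

theorem hasDerivAt_oscPhase (θ x s : ℝ) : HasDerivAt (oscPhase θ x) (s ^ 2 + x) s := by
  refine ((((hasDerivAt_pow 3 s).div_const 3).fun_add
    ((hasDerivAt_id s).const_mul x)).add_const θ).congr_deriv ?_
  norm_num

@[fun_prop]
theorem continuous_oscPhase (θ x : ℝ) : Continuous (oscPhase θ x) := by
  unfold oscPhase
  fun_prop

section

variable {a b : ℝ}

theorem intervalIntegrable_rpow_mul_of_pos (ha : 0 < a) (hab : a ≤ b) (p : ℝ) {g : ℝ → ℝ}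
    (hg : Continuous g) : IntervalIntegrable (fun s => s ^ p * g s) volume a b := by
  refine ContinuousOn.intervalIntegrable (ContinuousOn.mul ?_ hg.continuousOn)
  refine continuousOn_id.rpow_const fun s hs => Or.inl ?_
  rw [Set.uIcc_of_le hab] at hs
  exact (ha.trans_le hs.1).ne'

theorem hasDerivAt_oscJet (γ θ : ℝ) (ha : 0 < a) (hab : a ≤ b) (n : ℕ) (x : ℝ) :
    HasDerivAt (oscJet γ θ a b n) (oscJet γ θ a b (n + 1) x) x := by
  have hi := fun (n : ℕ) (x : ℝ) => intervalIntegrable_rpow_mul_of_pos ha hab (n - γ - 1)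
    (g := fun s => Real.cos (oscPhase θ x s + n * (Real.pi / 2))) (by fun_prop)
  refine (intervalIntegral.hasDerivAt_integral_of_dominated_loc_of_deriv_le
    (F' := fun x s => s ^ (((n + 1 : ℕ) : ℝ) - γ - 1) *
      Real.cos (oscPhase θ x s + (n + 1 : ℕ) * (Real.pi / 2)))
    (bound := fun s => s ^ (((n + 1 : ℕ) : ℝ) - γ - 1) * 1) univ_mem
    (Eventually.of_forall fun x => (hi n x).def'.aestronglyMeasurable) (hi n x)
    (hi (n + 1) x).def'.aestronglyMeasurable (Eventually.of_forall fun s hs x _ => ?_)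
    (intervalIntegrable_rpow_mul_of_pos ha hab _ continuous_const)
    (Eventually.of_forall fun s hs x _ => ?_)).2
  · rw [Set.uIoc_of_le hab] at hs
    have h := Real.rpow_nonneg (ha.trans hs.1).le (((n + 1 : ℕ) : ℝ) - γ - 1)
    rw [norm_mul, Real.norm_of_nonneg h]
    exact mul_le_mul_of_nonneg_left (Real.abs_cos_le_one _) h
  · rw [Set.uIoc_of_le hab] at hs
    have hs0 : 0 < s := ha.trans hs.1
    have h1 : HasDerivAt (fun x => oscPhase θ x s + n * (Real.pi / 2)) s x := by
      simpa [oscPhase] using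
        ((((hasDerivAt_id x).mul_const s).const_add (s ^ 3 / 3)).add_const θ).add_const
          (n * (Real.pi / 2))
    refine (h1.cos.const_mul _).congr_deriv ?_
    have e1 : ((n + 1 : ℕ) : ℝ) - γ - 1 = n - γ - 1 + 1 := by push_cast; ring
    have e2 : oscPhase θ x s + (n + 1 : ℕ) * (Real.pi / 2) =
        oscPhase θ x s + n * (Real.pi / 2) + Real.pi / 2 := by push_cast; ring
    rw [e1, e2, Real.rpow_add_one hs0.ne', Real.cos_add_pi_div_two]
    ring

theorem abs_oscJet_le (γ θ : ℝ) (ha : 0 < a) (hab : a ≤ b) (n : ℕ) (x : ℝ) :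
    |oscJet γ θ a b n x| ≤ ∫ s in a..b, s ^ (n - γ - 1) * 1 := by
  rw [← Real.norm_eq_abs]
  refine intervalIntegral.norm_integral_le_of_norm_le hab
    (Eventually.of_forall fun s hs => ?_)
    (intervalIntegrable_rpow_mul_of_pos ha hab _ continuous_const)
  have h := Real.rpow_nonneg (ha.trans hs.1).le (n - γ - 1)
  rw [norm_mul, Real.norm_of_nonneg h]
  exact mul_le_mul_of_nonneg_left (Real.abs_cos_le_one _) h

/-- Integration by parts in s, from x cos(phase) = ∂_s sin(phase) - s² cos(phase). This controls the
term x χ' ψ that arises when the operator meets the cut-off. -/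
theorem exists_mul_oscJet_bound (γ θ : ℝ) (ha : 0 < a) (hab : a ≤ b) :
    ∃ C, ∀ x, |x * oscJet γ θ a b 0 x| ≤ C := by
  have ib : IntervalIntegrable (fun s => s ^ (-γ - 1 - 1) * |-γ - 1| + s ^ (-γ - 1) * s ^ 2)
      volume a b :=
    (intervalIntegrable_rpow_mul_of_pos ha hab _ continuous_const).add
      (intervalIntegrable_rpow_mul_of_pos ha hab _ (by fun_prop))
  refine ⟨b ^ (-γ - 1) + a ^ (-γ - 1) +
    ∫ s in a..b, (s ^ (-γ - 1 - 1) * |-γ - 1| + s ^ (-γ - 1) * s ^ 2), fun x => ?_⟩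
  have i1 : IntervalIntegrable (fun s => s ^ (-γ - 1 - 1) * ((-γ - 1) *
      Real.sin (oscPhase θ x s)) + s ^ (-γ - 1) * (s ^ 2 * Real.cos (oscPhase θ x s)))
      volume a b :=
    (intervalIntegrable_rpow_mul_of_pos ha hab _ (by fun_prop)).add
      (intervalIntegrable_rpow_mul_of_pos ha hab _ (by fun_prop))
  have i2 : IntervalIntegrable (fun s => x * (s ^ (-γ - 1) * Real.cos (oscPhase θ x s)))
      volume a b :=
    (intervalIntegrable_rpow_mul_of_pos ha hab _ (by fun_prop)).const_mul x
  have key := intervalIntegral.integral_eq_sub_of_hasDerivAt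
    (f := fun s => s ^ (-γ - 1) * Real.sin (oscPhase θ x s)) (fun s hs => by
      rw [Set.uIcc_of_le hab] at hs
      exact ((Real.hasDerivAt_rpow_const (p := -γ - 1)
        (Or.inl (ha.trans_le hs.1).ne')).fun_mul (hasDerivAt_oscPhase θ x s).sin).congr_deriv
          (by ring : _ = (s ^ (-γ - 1 - 1) * ((-γ - 1) *
            Real.sin (oscPhase θ x s)) + s ^ (-γ - 1) * (s ^ 2 * Real.cos (oscPhase θ x s))) +
            x * (s ^ (-γ - 1) * Real.cos (oscPhase θ x s)))) (i1.add i2)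
  rw [intervalIntegral.integral_add i1 i2, intervalIntegral.integral_const_mul] at key
  have hosc : oscJet γ θ a b 0 x = ∫ s in a..b, s ^ (-γ - 1) * Real.cos (oscPhase θ x s) := by
    simp [oscJet]
  rw [hosc, eq_sub_of_add_eq' key]
  have hb : 0 < b := ha.trans_le hab
  have n1 : |∫ s in a..b, (s ^ (-γ - 1 - 1) * ((-γ - 1) * Real.sin (oscPhase θ x s)) +
      s ^ (-γ - 1) * (s ^ 2 * Real.cos (oscPhase θ x s)))| ≤
      ∫ s in a..b, (s ^ (-γ - 1 - 1) * |-γ - 1| + s ^ (-γ - 1) * s ^ 2) := by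
    rw [← Real.norm_eq_abs]
    refine intervalIntegral.norm_integral_le_of_norm_le hab
      (Eventually.of_forall fun s hs => ?_) ib
    have hs0 : 0 < s := ha.trans hs.1
    refine (norm_add_le _ _).trans ?_
    rw [norm_mul, norm_mul, norm_mul, norm_mul, Real.norm_of_nonneg (Real.rpow_nonneg hs0.le _),
      Real.norm_of_nonneg (Real.rpow_nonneg hs0.le _), Real.norm_of_nonneg (sq_nonneg s)]
    refine add_le_add (mul_le_mul_of_nonneg_left ?_ (Real.rpow_nonneg hs0.le _))
      (mul_le_mul_of_nonneg_left ?_ (Real.rpow_nonneg hs0.le _))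
    · exact mul_le_of_le_one_right (abs_nonneg _) (Real.abs_sin_le_one _)
    · exact mul_le_of_le_one_right (sq_nonneg _) (Real.abs_cos_le_one _)
  have n2 : ∀ {c : ℝ}, 0 < c → |c ^ (-γ - 1) * Real.sin (oscPhase θ x c)| ≤ c ^ (-γ - 1) := by
    intro c hc
    have h := Real.rpow_nonneg hc.le (-γ - 1)
    rw [abs_mul, abs_of_nonneg h]
    exact mul_le_of_le_one_right h (Real.abs_sin_le_one _)
  refine (abs_sub _ _).trans (add_le_add ((abs_sub _ _).trans (add_le_add ?_ ?_)) n1)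
  · exact n2 hb
  · exact n2 ha

/-- Under the integral sign the adjoint operator yields -∂_s (s^{-γ} cos(phase)); the weight
s^{-γ-1} is chosen for this. -/
theorem adjoint_oscJet (γ θ : ℝ) (ha : 0 < a) (hab : a ≤ b) (x : ℝ) :
    γ * oscJet γ θ a b 0 x - x * oscJet γ θ a b 1 x + oscJet γ θ a b 3 x =
      a ^ (-γ) * Real.cos (oscPhase θ x a) - b ^ (-γ) * Real.cos (oscPhase θ x b) := by
  have hi := fun (n : ℕ) => intervalIntegrable_rpow_mul_of_pos ha hab (n - γ - 1)
    (g := fun s => Real.cos (oscPhase θ x s + n * (Real.pi / 2))) (by fun_prop)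
  have i := (((hi 0).const_mul (-γ)).add ((hi 1).const_mul x)).sub (hi 3)
  have key := intervalIntegral.integral_eq_sub_of_hasDerivAt
    (f := fun s => s ^ (-γ) * Real.cos (oscPhase θ x s)) (fun s hs => by
      rw [Set.uIcc_of_le hab] at hs
      have hs0 : 0 < s := ha.trans_le hs.1
      refine ((Real.hasDerivAt_rpow_const (p := -γ) (Or.inl hs0.ne')).fun_mul
        (hasDerivAt_oscPhase θ x s).cos).congr_deriv
          (?_ : _ = -γ * (s ^ (((0 : ℕ) : ℝ) - γ - 1) *
            Real.cos (oscPhase θ x s + (0 : ℕ) * (Real.pi / 2))) + x * (s ^ (((1 : ℕ) : ℝ) - γ - 1)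
            * Real.cos (oscPhase θ x s + (1 : ℕ) * (Real.pi / 2))) - s ^ (((3 : ℕ) : ℝ) - γ - 1) *
            Real.cos (oscPhase θ x s + (3 : ℕ) * (Real.pi / 2)))
      have p0 : ((0 : ℕ) : ℝ) - γ - 1 = -γ - 1 := by push_cast; ring
      have p1 : ((1 : ℕ) : ℝ) - γ - 1 = -γ := by push_cast; ring
      have p3 : ((3 : ℕ) : ℝ) - γ - 1 = -γ + (2 : ℕ) := by push_cast; ring
      have c0 : oscPhase θ x s + (0 : ℕ) * (Real.pi / 2) = oscPhase θ x s := by push_cast; ring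
      have c1 : oscPhase θ x s + (1 : ℕ) * (Real.pi / 2) = oscPhase θ x s + Real.pi / 2 := by
        push_cast; ring
      have c3 : oscPhase θ x s + (3 : ℕ) * (Real.pi / 2) =
          oscPhase θ x s + Real.pi / 2 + Real.pi := by
        push_cast; ring
      rw [p0, p1, p3, c0, c1, c3, Real.cos_add_pi, Real.cos_add_pi_div_two,
        Real.rpow_add_natCast hs0.ne']
      ring) i
  rw [intervalIntegral.integral_sub (((hi 0).const_mul (-γ)).add ((hi 1).const_mul x)) (hi 3),
    intervalIntegral.integral_add ((hi 0).const_mul (-γ)) ((hi 1).const_mul x),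
    intervalIntegral.integral_const_mul, intervalIntegral.integral_const_mul] at key
  simp only [oscJet]
  linarith

end

/-! ### Uniqueness -/

section

variable {u u₁ : ℝ → ℝ}

/-- The Fourier integral of u need not converge absolutely; one integration by parts moves it to the
integrable u', and the term with χ' disappears in the limit. -/
theorem tendsto_integral_cutoff_cos {χ : ℕ → ℝ → ℝ}
    (hχ : ∀ k x, HasDerivAt (χ k) (χ (k + 1) x) x) (hχs : ∀ k, HasCompactSupport (χ k))
    (hχ0 : χ 0 0 = 1) (hχ1 : ∀ x, |χ 0 x| ≤ 1) (hu : ∀ x, HasDerivAt u (u₁ x) x)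
    (hu₁ : Continuous u₁) (hi : Integrable u₁) (hu0 : Tendsto u (cocompact ℝ) (nhds 0))
    {a : ℝ} (ha : a ≠ 0) (c : ℝ) :
    Tendsto (fun R : ℝ => ∫ x, χ 0 (x / R) * u x * Real.cos (a * x + c)) atTop
      (nhds (-(1 / a) * ∫ x, u₁ x * Real.sin (a * x + c))) := by
  have cu : Continuous u := continuous_iff_continuousAt.2 fun x => (hu x).continuousAt
  have cχ : ∀ k, Continuous (χ k) := fun k =>
    continuous_iff_continuousAt.2 fun x => (hχ k x).continuousAt
  have hv0 : Tendsto (fun x => u x * Real.sin (a * x + c)) (cocompact ℝ) (nhds 0) :=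
    hu0.zero_mul_isBoundedUnder_le ⟨1, by
      simp only [eventually_map]
      exact Eventually.of_forall fun x => Real.abs_sin_le_one _⟩
  have l1 := tendsto_integral_cutoff_deriv (cχ 1) (hχs 1)
    (v := fun x => u x * Real.sin (a * x + c)) (by fun_prop) hv0
  have l2 : Tendsto (fun R : ℝ => ∫ x, χ 0 (x / R) * (u₁ x * Real.sin (a * x + c))) atTop
      (nhds (∫ x, u₁ x * Real.sin (a * x + c))) := by
    refine tendsto_integral_filter_of_dominated_convergence (fun x => |u₁ x|) ?_ ?_ hi.abs ?_
    · refine Eventually.of_forall fun R => Continuous.aestronglyMeasurable ?_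
      have := cχ 0
      fun_prop
    · refine Eventually.of_forall fun R => Eventually.of_forall fun x => ?_
      rw [norm_mul, norm_mul]
      exact (mul_le_of_le_one_left (by positivity) (hχ1 _)).trans
        (mul_le_of_le_one_right (abs_nonneg _) (Real.abs_sin_le_one _))
    · refine Eventually.of_forall fun x => ?_
      have h1 : Tendsto (fun R : ℝ => χ 0 (x / R)) atTop (nhds (χ 0 0)) :=
        ((cχ 0).tendsto 0).comp (tendsto_const_nhds.div_atTop tendsto_id)
      simpa [hχ0] using h1.mul_const (u₁ x * Real.sin (a * x + c))
  have l3 := (l1.add l2).const_mul (-(1 / a))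
  rw [zero_add] at l3
  refine l3.congr' ?_
  filter_upwards [eventually_gt_atTop 0] with R hR
  have cs := fun k => hasCompactSupport_comp_div (hχs k) hR.ne'
  have c0 := cχ 0
  have c1 := cχ 1
  have j0 : Integrable fun x => χ 0 (x / R) * u x * Real.cos (a * x + c) :=
    Continuous.integrable_of_hasCompactSupport (by fun_prop) (cs 0).mul_right.mul_right
  have j1 : Integrable fun x => R⁻¹ * χ 1 (x / R) * (u x * Real.sin (a * x + c)) :=
    Continuous.integrable_of_hasCompactSupport (by fun_prop) (cs 1).mul_left.mul_right
  have j2 : Integrable fun x => χ 0 (x / R) * (u₁ x * Real.sin (a * x + c)) :=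
    Continuous.integrable_of_hasCompactSupport (by fun_prop) (cs 0).mul_right
  have j : Integrable fun x => χ 0 (x / R) * (u x * Real.sin (a * x + c)) :=
    Continuous.integrable_of_hasCompactSupport (by fun_prop) (cs 0).mul_right
  have key := integral_eq_zero_of_hasDerivAt_of_integrable (f' := fun x =>
    R⁻¹ * χ 1 (x / R) * (u x * Real.sin (a * x + c)) +
      χ 0 (x / R) * (u₁ x * Real.sin (a * x + c)) +
      a * (χ 0 (x / R) * u x * Real.cos (a * x + c))) (fun x => ?_)
      ((j1.add j2).add (j0.const_mul a)) j
  · rw [integral_add (j1.fun_add j2) (j0.const_mul a), integral_add j1 j2,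
      integral_const_mul] at key
    rw [eq_neg_of_add_eq_zero_left key]
    field_simp
  · have d1 : HasDerivAt (fun x => χ 0 (x / R)) (χ 1 (x / R) * (1 / R)) x :=
      (hχ 0 (x / R)).comp x ((hasDerivAt_id x).div_const R)
    have d2 : HasDerivAt (fun x => a * x + c) a x := by
      simpa using ((hasDerivAt_id x).const_mul a).add_const c
    refine (d1.fun_mul ((hu x).fun_mul d2.sin)).congr_deriv ?_
    ring

/-- The weak equation is tested with χ(x/R) ψ(x), ψ the oscillatory integral over [a, b], and R → ∞.
The two endpoint terms must then balance. -/
theorem integral_deriv_mul_sin_eq {γ : ℝ} (hu : ∀ x, HasDerivAt u (u₁ x) x)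
    (hu₁ : Continuous u₁) (hi : Integrable u₁) (hu0 : Tendsto u (cocompact ℝ) (nhds 0))
    (hw : WeakEqL γ u 0) {a b : ℝ} (ha : 0 < a) (hab : a ≤ b) (θ : ℝ) :
    a ^ (-γ) * (-(1 / a) * ∫ x, u₁ x * Real.sin (a * x + (a ^ 3 / 3 + θ))) =
      b ^ (-γ) * (-(1 / b) * ∫ x, u₁ x * Real.sin (b * x + (b ^ 3 / 3 + θ))) := by
  obtain ⟨χ, hχ, hχs, hχ0, hχ1⟩ := exists_cutoff_jet
  have hb : 0 < b := ha.trans_le hab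
  have cu : Continuous u := continuous_iff_continuousAt.2 fun x => (hu x).continuousAt
  have cχ : ∀ k, Continuous (χ k) := fun k =>
    continuous_iff_continuousAt.2 fun x => (hχ k x).continuousAt
  set ψ := oscJet γ θ a b with hψdef
  have hψ : ∀ k x, HasDerivAt (ψ k) (ψ (k + 1) x) x := hasDerivAt_oscJet γ θ ha hab
  have cψ : ∀ k, Continuous (ψ k) := fun k =>
    continuous_iff_continuousAt.2 fun x => (hψ k x).continuousAt
  have bψ : ∀ k, IsBoundedUnder (· ≤ ·) (cocompact ℝ) (norm ∘ ψ k) := fun k =>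
    ⟨_, eventually_map.2 (Eventually.of_forall (abs_oscJet_le γ θ ha hab k))⟩
  obtain ⟨C, hC⟩ := exists_mul_oscJet_bound γ θ ha hab
  -- The factor 3ψ'' - xψ is what multiplies χ'(x/R)/R in the adjoint operator applied to the
  -- product.
  have t1 : Tendsto (fun x => u x * (3 * ψ 2 x - x * ψ 0 x)) (cocompact ℝ) (nhds 0) := by
    have h1 := (hu0.zero_mul_isBoundedUnder_le (bψ 2)).const_mul 3
    have h2 : Tendsto (fun x => u x * (x * ψ 0 x)) (cocompact ℝ) (nhds 0) :=
      hu0.zero_mul_isBoundedUnder_le ⟨C, eventually_map.2 (Eventually.of_forall hC)⟩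
    have h3 := h1.sub h2
    rw [mul_zero, sub_zero] at h3
    exact h3.congr fun x => by ring
  have t2 := hu0.zero_mul_isBoundedUnder_le (bψ 1)
  have t3 := hu0.zero_mul_isBoundedUnder_le (bψ 0)
  have c0 := cψ 0
  have c1 := cψ 1
  have c2 := cψ 2
  have x0 := cχ 0
  have x1 := cχ 1
  have x2 := cχ 2
  have x3 := cχ 3
  have l1 := tendsto_integral_cutoff_deriv (cχ 1) (hχs 1) (by fun_prop) t1
  have l2 := (tendsto_integral_cutoff_deriv (cχ 2) (hχs 2) (by fun_prop) t2).mul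
    (tendsto_inv_atTop_zero.const_mul (3 : ℝ))
  have l3 := (tendsto_integral_cutoff_deriv (cχ 3) (hχs 3) (by fun_prop) t3).mul
    (tendsto_inv_atTop_zero.mul tendsto_inv_atTop_zero)
  have la := (tendsto_integral_cutoff_cos hχ hχs hχ0 hχ1 hu hu₁ hi hu0 ha.ne'
    (a ^ 3 / 3 + θ)).const_mul (a ^ (-γ))
  have lb := (tendsto_integral_cutoff_cos hχ hχs hχ0 hχ1 hu hu₁ hi hu0 hb.ne'
    (b ^ 3 / 3 + θ)).const_mul (b ^ (-γ))
  have l := (((la.sub lb).add l1).add l2).add l3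
  simp only [mul_zero, add_zero] at l
  rw [← sub_eq_zero]
  refine tendsto_nhds_unique_of_eventuallyEq l tendsto_const_nhds ?_
  filter_upwards [eventually_gt_atTop 0] with R hR
  have cs := fun k => hasCompactSupport_comp_div (hχs k) hR.ne'
  have dX : ∀ k x, HasDerivAt (fun x => χ k (x / R)) (R⁻¹ * χ (k + 1) (x / R)) x := by
    intro k x
    refine ((hχ k (x / R)).comp x ((hasDerivAt_id x).div_const R)).congr_deriv ?_
    ring
  have e1 : ∀ x, HasDerivAt (fun x => χ 0 (x / R) * ψ 0 x)
      (R⁻¹ * χ 1 (x / R) * ψ 0 x + χ 0 (x / R) * ψ 1 x) x := fun x =>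
    (dX 0 x).fun_mul (hψ 0 x)
  have e2 : ∀ x, HasDerivAt (fun x => R⁻¹ * χ 1 (x / R) * ψ 0 x + χ 0 (x / R) * ψ 1 x)
      (R⁻¹ * R⁻¹ * χ 2 (x / R) * ψ 0 x + 2 * (R⁻¹ * χ 1 (x / R) * ψ 1 x) +
        χ 0 (x / R) * ψ 2 x) x := fun x =>
    ((((dX 1 x).const_mul R⁻¹).fun_mul (hψ 0 x)).fun_add
      ((dX 0 x).fun_mul (hψ 1 x))).congr_deriv (by ring)
  have e3 : ∀ x, HasDerivAt (fun x => R⁻¹ * R⁻¹ * χ 2 (x / R) * ψ 0 x +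
        2 * (R⁻¹ * χ 1 (x / R) * ψ 1 x) + χ 0 (x / R) * ψ 2 x)
      (R⁻¹ * R⁻¹ * R⁻¹ * χ 3 (x / R) * ψ 0 x + 3 * (R⁻¹ * R⁻¹ * χ 2 (x / R) * ψ 1 x) +
        3 * (R⁻¹ * χ 1 (x / R) * ψ 2 x) + χ 0 (x / R) * ψ 3 x) x := fun x =>
    (((((dX 2 x).const_mul (R⁻¹ * R⁻¹)).fun_mul (hψ 0 x)).fun_add
      ((((dX 1 x).const_mul R⁻¹).fun_mul (hψ 1 x)).const_mul 2)).fun_add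
      ((dX 0 x).fun_mul (hψ 2 x))).congr_deriv (by ring)
  have hφ : ContDiff ℝ ∞ fun x => χ 0 (x / R) * ψ 0 x :=
    ((contDiff_of_jet hχ 0).comp (contDiff_id.div_const R)).mul (contDiff_of_jet hψ 0)
  have w := hw _ hφ (cs 0).mul_right
  simp only [adjoint_expr_eq e1 e2 e3, Pi.zero_apply, zero_mul, integral_zero] at w
  have ia : Integrable fun x => χ 0 (x / R) * u x * Real.cos (a * x + (a ^ 3 / 3 + θ)) :=
    Continuous.integrable_of_hasCompactSupport (by fun_prop) (cs 0).mul_right.mul_right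
  have ib : Integrable fun x => χ 0 (x / R) * u x * Real.cos (b * x + (b ^ 3 / 3 + θ)) :=
    Continuous.integrable_of_hasCompactSupport (by fun_prop) (cs 0).mul_right.mul_right
  have i1 : Integrable fun x => R⁻¹ * χ 1 (x / R) * (u x * (3 * ψ 2 x - x * ψ 0 x)) :=
    Continuous.integrable_of_hasCompactSupport (by fun_prop) (cs 1).mul_left.mul_right
  have i2 : Integrable fun x => R⁻¹ * χ 2 (x / R) * (u x * ψ 1 x) :=
    Continuous.integrable_of_hasCompactSupport (by fun_prop) (cs 2).mul_left.mul_right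
  have i3 : Integrable fun x => R⁻¹ * χ 3 (x / R) * (u x * ψ 0 x) :=
    Continuous.integrable_of_hasCompactSupport (by fun_prop) (cs 3).mul_left.mul_right
  have iab : Integrable fun x =>
      a ^ (-γ) * (χ 0 (x / R) * u x * Real.cos (a * x + (a ^ 3 / 3 + θ))) -
        b ^ (-γ) * (χ 0 (x / R) * u x * Real.cos (b * x + (b ^ 3 / 3 + θ))) :=
    (ia.const_mul _).sub (ib.const_mul _)
  rw [← w, ← integral_const_mul, ← integral_const_mul, ← integral_mul_const,
    ← integral_mul_const,
    ← integral_sub (ia.const_mul _) (ib.const_mul _),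
    ← integral_add iab i1, ← integral_add (iab.fun_add i1) (i2.mul_const _),
    ← integral_add ((iab.fun_add i1).fun_add (i2.mul_const _)) (i3.mul_const _)]
  refine integral_congr_ae (Eventually.of_forall fun x => ?_)
  have had := adjoint_oscJet γ θ ha hab x
  have pa : oscPhase θ x a = a * x + (a ^ 3 / 3 + θ) := by rw [oscPhase]; ring
  have pb : oscPhase θ x b = b * x + (b ^ 3 / 3 + θ) := by rw [oscPhase]; ring
  rw [pa, pb, ← hψdef] at had
  simp only
  linear_combination (-(u x * χ 0 (x / R))) * had

/-- The quantity at frequency a equals the one at b, which is at most b^{-(1+γ)} ∫ |u'| and tends to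
zero as b → ∞. -/
theorem integral_deriv_mul_sin_eq_zero {γ : ℝ} (hγ : -1 < γ) (hu : ∀ x, HasDerivAt u (u₁ x) x)
    (hu₁ : Continuous u₁) (hi : Integrable u₁) (hu0 : Tendsto u (cocompact ℝ) (nhds 0))
    (hw : WeakEqL γ u 0) {a : ℝ} (ha : 0 < a) (θ : ℝ) :
    ∫ x, u₁ x * Real.sin (a * x + θ) = 0 := by
  -- The shift by a³/3 makes the phase at frequency a arbitrary; the phase left at b does not affect
  -- the bound.
  have key := fun b hab => integral_deriv_mul_sin_eq hu hu₁ hi hu0 hw ha (b := b) hab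
    (θ - a ^ 3 / 3)
  rw [add_sub_cancel] at key
  set S := ∫ x, u₁ x * Real.sin (a * x + θ) with hS
  have hlim : Tendsto (fun _ : ℝ => a ^ (-γ) * (-(1 / a) * S)) atTop (nhds 0) := by
    refine squeeze_zero_norm' (a := fun b => b ^ (-(1 + γ)) * ∫ x, |u₁ x|) ?_ ?_
    · filter_upwards [eventually_ge_atTop a] with b hab
      have hb : 0 < b := ha.trans_le hab
      rw [key b hab, ← mul_assoc, norm_mul]
      refine mul_le_mul (le_of_eq ?_) ?_ (norm_nonneg _) (Real.rpow_nonneg hb.le _)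
      · rw [mul_neg, norm_neg, one_div, ← Real.rpow_neg_one, ← Real.rpow_add hb,
          Real.norm_of_nonneg (Real.rpow_nonneg hb.le _)]
        congr 1
        ring
      · refine norm_integral_le_of_norm_le hi.abs (Eventually.of_forall fun x => ?_)
        rw [norm_mul]
        exact mul_le_of_le_one_right (abs_nonneg _) (Real.abs_sin_le_one _)
    · simpa using (tendsto_rpow_neg_atTop (y := 1 + γ) (by linarith)).mul_const (∫ x, |u₁ x|)
  have h0 := tendsto_nhds_unique hlim tendsto_const_nhds
  have h1 := (Real.rpow_pos_of_pos ha (-γ)).ne'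
  simpa [h1, ha.ne'] using h0.symm

/-- The phases π/2 and 0 give the real and imaginary parts of the Fourier transform. It vanishes off
the null set {0}, and Fourier inversion applies to the continuous w. -/
theorem eq_zero_of_integral_mul_sin_eq_zero {w : ℝ → ℝ} (hw : Continuous w) (hi : Integrable w)
    (h : ∀ a > 0, ∀ θ, ∫ x, w x * Real.sin (a * x + θ) = 0) (x : ℝ) : w x = 0 := by
  have h' : ∀ a ≠ 0, ∀ θ, ∫ x, w x * Real.sin (a * x + θ) = 0 := by
    intro a ha θ
    rcases lt_or_gt_of_ne ha with hn | hp
    · have := h (-a) (by linarith) (-θ)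
      rw [← neg_eq_zero, ← integral_neg, ← this]
      refine integral_congr_ae (Eventually.of_forall fun x => ?_)
      dsimp only
      rw [show -a * x + -θ = -(a * x + θ) by ring, Real.sin_neg]
      ring
    · exact h a hp θ
  have hF : ∀ ξ : ℝ, ξ ≠ 0 → FourierTransform.fourier (fun x => (w x : ℂ)) ξ = 0 := by
    intro ξ hξ
    have ha : -2 * Real.pi * ξ ≠ 0 := by simp [hξ, Real.pi_ne_zero]
    have i1 : Integrable fun x => w x * Real.sin (-2 * Real.pi * ξ * x + Real.pi / 2) :=
      hi.mul_bdd (c := 1) (by fun_prop) (Eventually.of_forall fun x => Real.abs_sin_le_one _)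
    have i2 : Integrable fun x => w x * Real.sin (-2 * Real.pi * ξ * x + 0) :=
      hi.mul_bdd (c := 1) (by fun_prop) (Eventually.of_forall fun x => Real.abs_sin_le_one _)
    rw [Real.fourier_eq']
    have e : ∀ x : ℝ, Complex.exp (((-2 * Real.pi * inner ℝ x ξ : ℝ) : ℂ) * Complex.I) • (w x : ℂ) =
        ((w x * Real.sin (-2 * Real.pi * ξ * x + Real.pi / 2) : ℝ) : ℂ) +
        ((w x * Real.sin (-2 * Real.pi * ξ * x + 0) : ℝ) : ℂ) * Complex.I := by
      intro x
      have hin : -2 * Real.pi * inner ℝ x ξ = -2 * Real.pi * ξ * x := by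
        simp; ring
      rw [hin, Complex.exp_mul_I, Real.sin_add_pi_div_two, add_zero, smul_eq_mul,
        ← Complex.ofReal_cos, ← Complex.ofReal_sin]
      push_cast
      ring
    simp only [e]
    rw [integral_add i1.ofReal (i2.ofReal.mul_const _), integral_mul_const,
      integral_complex_ofReal, integral_complex_ofReal, h' _ ha, h' _ ha]
    simp
  have hF0 : FourierTransform.fourier (fun x => (w x : ℂ)) =ᵐ[volume] fun _ : ℝ => (0 : ℂ) := by
    have h0 : ∀ᵐ ξ : ℝ, ξ ≠ 0 := by simp [ae_iff]
    filter_upwards [h0] with ξ hξ using hF ξ hξ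
  have hinv := Integrable.fourierInv_fourier_eq (f := fun x => (w x : ℂ)) hi.ofReal
    ((integrable_zero ℝ ℂ volume).congr hF0.symm) (v := x) (by fun_prop)
  rw [Real.fourierInv_eq', integral_congr_ae (g := fun _ => (0 : ℂ)) (by
    filter_upwards [hF0] with ξ hξ
    rw [hξ, smul_zero]), integral_zero] at hinv
  exact_mod_cast hinv.symm

end

theorem eq_zero_of_mem_spaceX_of_weakEqL {γ : ℝ} (hγ : -1 < γ) {u : ℝ → ℝ} (hu : u ∈ spaceX γ)
    (hw : WeakEqL γ u 0) : u = 0 := by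
  obtain ⟨hc, D, hD⟩ := hu
  have hD' : ∀ x, (1 + |x|) ^ (1 + γ) * |u x| + (1 + |x|) ^ (2 + γ) * |deriv u x| ≤ D :=
    fun x => hD ⟨x, rfl⟩
  have hd : ∀ x, HasDerivAt u (deriv u x) x := fun x =>
    (hc.differentiable one_ne_zero x).hasDerivAt
  have hc1 : Continuous (deriv u) := hc.continuous_deriv le_rfl
  have b0 : ∀ x, |u x| ≤ D * (1 + |x|) ^ (-(1 + γ)) := by
    intro x
    have hp : 0 < (1 + |x|) ^ (1 + γ) := by positivity
    have hq : 0 ≤ (1 + |x|) ^ (2 + γ) * |deriv u x| := by positivity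
    rw [Real.rpow_neg (by positivity), ← div_eq_mul_inv, le_div_iff₀ hp]
    linarith [hD' x]
  have b1 : ∀ x, |deriv u x| ≤ D * (1 + |x|) ^ (-(2 + γ)) := by
    intro x
    have hp : 0 < (1 + |x|) ^ (2 + γ) := by positivity
    have hq : 0 ≤ (1 + |x|) ^ (1 + γ) * |u x| := by positivity
    rw [Real.rpow_neg (by positivity), ← div_eq_mul_inv, le_div_iff₀ hp]
    linarith [hD' x]
  -- Here γ > -1 enters as 2 + γ > 1; below, as 1 + γ > 0, it makes u vanish at infinity.
  have hi : Integrable (deriv u) :=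
    ((integrable_one_add_norm (E := ℝ) (μ := volume) (r := 2 + γ)
      (by simp; linarith)).const_mul D).mono' hc1.aestronglyMeasurable (Eventually.of_forall b1)
  have hu0 : Tendsto u (cocompact ℝ) (nhds 0) := by
    refine squeeze_zero_norm b0 ?_
    have h1 : Tendsto (fun x : ℝ => 1 + |x|) (cocompact ℝ) atTop :=
      tendsto_atTop_add_const_left _ _ (tendsto_norm_cocompact_atTop (E := ℝ))
    simpa using ((tendsto_rpow_neg_atTop (y := 1 + γ) (by linarith)).comp h1).const_mul D
  have hz : ∀ x, deriv u x = 0 := eq_zero_of_integral_mul_sin_eq_zero hc1 hi fun a ha θ =>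
    integral_deriv_mul_sin_eq_zero hγ hd hc1 hi hu0 hw ha θ
  have hconst := is_const_of_deriv_eq_zero (hc.differentiable one_ne_zero) hz
  funext x
  refine tendsto_nhds_unique ?_ hu0
  exact tendsto_const_nhds.congr fun y => hconst x y

/-! ### The solution operator -/

theorem WeakEqL.sub {γ : ℝ} {u v f : ℝ → ℝ} (hu : Continuous u) (hv : Continuous v)
    (h : WeakEqL γ u f) (h' : WeakEqL γ v f) : WeakEqL γ (u - v) 0 := by
  intro φ hφ hs
  have s1 := contDiff_infty_iff_deriv.1 hφ
  have s2 := contDiff_infty_iff_deriv.1 s1.2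
  have s3 := contDiff_infty_iff_deriv.1 s2.2
  have d1 := fun x => (s1.1 x).hasDerivAt
  have d2 := fun x => (s2.1 x).hasDerivAt
  have d3 := fun x => (s3.1 x).hasDerivAt
  have e := h φ hφ hs
  have e' := h' φ hφ hs
  simp only [adjoint_expr_eq d1 d2 d3] at e e' ⊢
  have c0 := hφ.continuous
  have c1 := s1.2.continuous
  have c3 := s3.2.continuous
  have k : HasCompactSupport fun x => γ * φ x - x * deriv φ x + deriv (deriv (deriv φ)) x :=
    ((hs.mul_left).sub hs.deriv.mul_left).add hs.deriv.deriv.deriv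
  have i : Integrable fun x =>
      u x * (γ * φ x - x * deriv φ x + deriv (deriv (deriv φ)) x) :=
    Continuous.integrable_of_hasCompactSupport (by fun_prop) k.mul_left
  have i' : Integrable fun x =>
      v x * (γ * φ x - x * deriv φ x + deriv (deriv (deriv φ)) x) :=
    Continuous.integrable_of_hasCompactSupport (by fun_prop) k.mul_left
  simp only [Pi.sub_apply, sub_mul, Pi.zero_apply, zero_mul, integral_zero]
  rw [integral_sub i i', e, e', sub_self]

theorem eq_of_mem_spaceX_of_weakEqL {γ : ℝ} (hγ : -1 < γ) {f : ℝ → ℝ} {u v : spaceX γ}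
    (hu : WeakEqL γ u f) (hv : WeakEqL γ v f) : u = v :=
  Subtype.ext <| sub_eq_zero.1 <| eq_zero_of_mem_spaceX_of_weakEqL hγ (u - v).2 <|
    hu.sub u.2.1.continuous v.2.1.continuous hv

/-- The solution operator given by the kernel. -/
noncomputable def greenOperator {γ : ℝ} (hγ : -1 < γ) (hγ' : γ < 0) :
    C_c(ℝ, ℝ) →ₗ[ℝ] spaceX γ where
  toFun f := ⟨greenJet γ f 0, greenJet_mem_spaceX hγ hγ' (map_continuous f) f.hasCompactSupport⟩
  map_add' f g := by
    ext x
    -- Linearity is read off from the kernel representation.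
    change greenJet γ (f + g : C_c(ℝ, ℝ)) 0 x = greenJet γ f 0 x + greenJet γ g 0 x
    rw [greenJet_eq_integral hγ hγ' (map_continuous (f + g)) (f + g).hasCompactSupport,
      greenJet_eq_integral hγ hγ' (map_continuous f) f.hasCompactSupport,
      greenJet_eq_integral hγ hγ' (map_continuous g) g.hasCompactSupport,
      ← integral_add
        (integrable_greenKernel_mul hγ hγ' (map_continuous f) f.hasCompactSupport x)
        (integrable_greenKernel_mul hγ hγ' (map_continuous g) g.hasCompactSupport x)]
    simp only [CompactlySupportedContinuousMap.coe_add, Pi.add_apply, mul_add]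
  map_smul' c f := by
    ext x
    change greenJet γ (c • f : C_c(ℝ, ℝ)) 0 x = c * greenJet γ f 0 x
    rw [greenJet_eq_integral hγ hγ' (map_continuous (c • f)) (c • f).hasCompactSupport,
      greenJet_eq_integral hγ hγ' (map_continuous f) f.hasCompactSupport, ← integral_const_mul]
    simp only [CompactlySupportedContinuousMap.coe_smul, Pi.smul_apply, smul_eq_mul,
      mul_left_comm c]

theorem theorem5p1 (γ : ℝ) (hγ : -1 < γ) (hγ' : γ < 0) :
    ∃ T : C_c(ℝ, ℝ) →ₗ[ℝ] spaceX γ,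
      IsRightInverseL γ T ∧
      (∀ f : C_c(ℝ, ℝ), ContDiff ℝ 3 (T f : ℝ → ℝ) ∧ ∀ x, opL γ (T f : ℝ → ℝ) x = f x) ∧
      (∀ (f : C_c(ℝ, ℝ)) (x : ℝ), Integrable (fun y => greenKernel γ x y * f y) ∧
        (T f : ℝ → ℝ) x = ∫ y, greenKernel γ x y * f y) ∧
      (∀ S : C_c(ℝ, ℝ) → spaceX γ, IsRightInverseL γ S → S = T) := by
  have hT : IsRightInverseL γ (greenOperator hγ hγ') := fun f =>
    weakEqL_of_hasDerivAt (map_continuous f)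
      (hasDerivAt_greenJet_zero hγ hγ' (map_continuous f) f.hasCompactSupport)
      (hasDerivAt_greenJet_one hγ hγ' (map_continuous f) f.hasCompactSupport)
      (hasDerivAt_greenJet_two hγ hγ' (map_continuous f) f.hasCompactSupport)
  refine ⟨greenOperator hγ hγ', hT, fun f => ⟨?_, ?_⟩, fun f x => ⟨?_, ?_⟩, fun S hS => ?_⟩
  · exact contDiff_greenJet hγ hγ' (map_continuous f) f.hasCompactSupport
  · exact opL_greenJet hγ hγ' (map_continuous f) f.hasCompactSupport
  · exact integrable_greenKernel_mul hγ hγ' (map_continuous f) f.hasCompactSupport x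
  · exact greenJet_eq_integral hγ hγ' (map_continuous f) f.hasCompactSupport x
  · exact funext fun f => eq_of_mem_spaceX_of_weakEqL hγ (hS f) (hT f)
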